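/- **Setting.** A hypergraph $g=(V,E,\mathrm{att},\mathrm{lab},\mathrm{ext})$ has a finite nonempty node set $V$, a finite set $E$ of edges, each edge $e$ being attached to a nonempty sequence $\mathrm{att}(e)$ of pairwise distinct nodes and labelled by a symbol of rank $\mathrm{rank}(e)=|\mathrm{att}(e)|$, and a sequence $\mathrm{ext}$ of pairwise distinct external nodes; $\mathrm{rank}(g)=|\mathrm{ext}|$. Its size is $|g|=|V|+\sum_{e\in E}s(\mathrm{rank}(e))$, where $s(j)=1$ for $j\le 2$ and $s(j)=j$ for $j>2$. A grammar $G$ consists of a start graph $S$ and one rule $A\to \mathrm{rhs}(A)$ with $\mathrm{rank}(\mathrm{rhs}(A))=\mathrm{rank}(A)$ for each nonterminal $A$; $|G|$ is the sum of the sizes of all right-hand sides, including $S$. A digram is a hypergraph $d$ with exactly two edges, which share a node, without isolated nodes, and with $\mathrm{ext}_d\neq\varepsilon$. An occurrence of $d$ in $g$ is a set $o$ of two edges of $g$ which, together with their nodes, form a copy of $d$ (labels and attachment sequences being preserved) such that a node of the copy corresponds to an external node of $d$ if and only if it is attached to an edge of $g$ outside $o$ or is external in $g$. Two occurrences overlap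 if they share an edge. gRePair with maximal rank $r\in\mathbb N\cup\{\infty\}$ works on a graph $g$ as follows. Start with $S=g$ and no rules. As long as some digram of rank at most $r$ has at least two non-overlapping occurrences in $S$, choose a digram $d$ of rank at most $r$ with the largest number of pairwise non-overlapping occurrences, choose a maximum set of such occurrences, replace each of them by an edge labelled by a fresh nonterminal $A$ (attached to the images of $\mathrm{ext}_d$; the images of internal nodes of $d$ are deleted), and add the rule $A\to d$. Then, if $S$ is disconnected, connect its components by virtual edges and run the loop again. Then prune: remove (by applying its rule everywhere) every nonterminal that is referenced exactly once, then traverse the remaining nonterminals bottom-up and remove each $A$ whose current contribution $|\mathrm{ref}(A)|\,(|\mathrm{rhs}(A)|-|\mathrm{handle}(A)|)-|\mathrm{rhs}(A)|$ is at most $0$, where $|\mathrm{ref}(A)|$ is the number of $A$-labelled edges in the grammar and $|\mathrm{handle}(A)|=\mathrm{rank}(A)+s(\mathrm{rank}(A))$. Finally delete the virtual edges. All remaining choices are arbitrary. For $n\ge 0$ and $k\ge 1$ let $s_{n,k}$ be the right comb with $2^n$ nodes labelled $f_k$, each having $k$ children: the first $k-1$ children are leaves labelled $a$, and the last child is the next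 $f_k$-node, except that the last $f_k$-node has only $a$-labelled leaves as children. Let $g_{n,k}$ be its tree-graph: its nodes are the nodes of $s_{n,k}$, the root is the only external node, and each tree node $u$ with label $\sigma$ and children $u_1,\dots,u_j$ (from left to right) yields one edge labelled $\sigma$ attached to $u\,u_1\cdots u_j$. **Lemma.** 1. There is a constant $C$ such that for all $n\ge 0$, $k\ge 1$ and every maximal rank $r\ge\max(k,2)$, gRePair with maximal rank $r$ produces an output on $g_{n,k}$, and each of its possible outputs $G$ satisfies $|G|\le C\,(k^2+n)$. 2. For all $n\ge 0$, $k\ge 1$ and every maximal rank $r<k$, gRePair with maximal rank $r$ does not compress $g_{n,k}$ at all: its only output is the grammar without nonterminals whose start graph is $g_{n,k}$, which has size $|g_{n,k}|$. -/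

import Mathlib

namespace GRePair

/-! ### Hypergraphs -/

/-- Ranked symbols.  A symbol consists of its name together with its rank; the alphabet of terminals
and the alphabet of nonterminals are disjoint.  `virt` is a reserved terminal of rank two, the label
of the virtual edges which connect the components of a disconnected graph. -/
inductive Symb where
  | term (name rank : ℕ) : Symb
  | nonterm (name rank : ℕ) : Symb
  | virt : Symb
deriving DecidableEq

/-- The rank of a symbol. -/
def Symb.rank : Symb → ℕ
  | .term _ r => r
  | .nonterm _ r => r
  | .virt => 2

/-- A hyperedge: its label and the sequence of nodes to which it is attached. -/
structure Edge where
  lab : Symb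
  att : List ℕ
deriving DecidableEq

/-- The rank of an edge is the number of nodes to which it is attached. -/
def Edge.rank (e : Edge) : ℕ := e.att.length

/-- Renaming of the nodes of an edge. -/
def Edge.rename (ρ : ℕ → ℕ) (e : Edge) : Edge := ⟨e.lab, e.att.map ρ⟩

/-- A hypergraph `(V, E, att, lab, ext)`.  The family of edges with their labels and attachments is
recorded as a multiset of pairs `(lab e, att e)`, so that parallel edges with the same label are
counted with multiplicity. -/
structure HGraph where
  V : Finset ℕ
  E : Multiset Edge
  ext : List ℕ

/-- The requirements on hypergraphs: there is a node, every edge is attached to at least one node,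
the number of attached nodes is the rank of the label, no edge is attached to a node twice, and no
node is external twice. -/
structure HGraph.IsHypergraph (g : HGraph) : Prop where
  nonempty : g.V.Nonempty
  att_subset : ∀ e ∈ g.E, ∀ v ∈ e.att, v ∈ g.V
  att_nodup : ∀ e ∈ g.E, e.att.Nodup
  att_ne_nil : ∀ e ∈ g.E, e.att ≠ []
  rank_lab : ∀ e ∈ g.E, e.rank = e.lab.rank
  ext_subset : ∀ v ∈ g.ext, v ∈ g.V
  ext_nodup : g.ext.Nodup

/-- The rank of a hypergraph is the number of its external nodes. -/
def HGraph.rank (g : HGraph) : ℕ := g.ext.length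

/-- The size of an edge of rank `r`. -/
def edgeSize (r : ℕ) : ℕ := if r ≤ 2 then 1 else r

/-- The size of a hypergraph: the number of nodes plus the sizes of the edges. -/
def HGraph.size (g : HGraph) : ℕ := g.V.card + (g.E.map fun e => edgeSize e.rank).sum

/-- The number of edges with label `A`. -/
def HGraph.countLab (g : HGraph) (A : Symb) : ℕ := (g.E.filter fun e => e.lab = A).card

/-! ### Digrams and their occurrences -/

/-- A digram: a hypergraph with exactly two edges which share a node, without isolated nodes, and
with at least one external node. -/
def HGraph.IsDigram (d : HGraph) : Prop :=
  d.IsHypergraph ∧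
  ∃ e₁ e₂ : Edge, d.E = {e₁, e₂} ∧
    (∀ v ∈ d.V, v ∈ e₁.att ∨ v ∈ e₂.att) ∧
    (∃ v ∈ d.V, v ∈ e₁.att ∧ v ∈ e₂.att) ∧
    d.ext ≠ []

/-- The pair of edges which is the image of the digram `d` under the node map `φ`. -/
def occEdges (d : HGraph) (φ : ℕ → ℕ) : Multiset Edge := d.E.map (Edge.rename φ)

/-- `φ` describes an occurrence of the digram `d` in `g`: it embeds `d` into `g` (so that the two
edges `occEdges d φ` induce a copy of `d`), and a node of `d` is external if and only if its image
is attached to a further edge of `g` or is an external node of `g`. -/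
structure IsOccurrence (g d : HGraph) (φ : ℕ → ℕ) : Prop where
  inj : Set.InjOn φ d.V
  edges_le : occEdges d φ ≤ g.E
  ext_iff : ∀ v ∈ d.V,
    v ∈ d.ext ↔ (∃ e ∈ g.E - occEdges d φ, φ v ∈ e.att) ∨ φ v ∈ g.ext

/-- `L` is a list of pairwise non-overlapping occurrences of `d` in `g`: no edge of `g` is used by
two of them. -/
def IsNonOverlapping (g d : HGraph) (L : List (ℕ → ℕ)) : Prop :=
  (∀ φ ∈ L, IsOccurrence g d φ) ∧ (L.map (occEdges d)).sum ≤ g.E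

/-- `d` is an active digram of rank at most `r` in `g`: it has at least two non-overlapping
occurrences. -/
def IsActive (r : ℕ∞) (g d : HGraph) : Prop :=
  d.IsDigram ∧ (d.rank : ℕ∞) ≤ r ∧ ∃ L, IsNonOverlapping g d L ∧ 2 ≤ L.length

/-- Among the digrams of rank at most `r`, `d` is one with the largest number of non-overlapping
occurrences in `g`, and `L` is a maximum list of non-overlapping occurrences of `d`. -/
def IsMostFrequent (r : ℕ∞) (g d : HGraph) (L : List (ℕ → ℕ)) : Prop :=
  d.IsDigram ∧ (d.rank : ℕ∞) ≤ r ∧ IsNonOverlapping g d L ∧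
    ∀ (d' : HGraph) (L' : List (ℕ → ℕ)), d'.IsDigram → (d'.rank : ℕ∞) ≤ r →
      IsNonOverlapping g d' L' → L'.length ≤ L.length

open Classical in
/-- Replacement in `g` of all the occurrences of `d` in the list `L` by edges with label `A`: the two
edges and the removal nodes (the images of the internal nodes of `d`) of each occurrence are removed,
and a new `A`-edge is attached to its attachment nodes, in the order given by the external nodes of
`d`. -/
noncomputable def replaceOccs (g d : HGraph) (A : Symb) (L : List (ℕ → ℕ)) : HGraph where
  V := g.V.filter fun v => ¬ ∃ φ ∈ L, ∃ u ∈ d.V, u ∉ d.ext ∧ φ u = v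
  E := g.E - (L.map (occEdges d)).sum +
    ((L.map fun φ => (⟨A, d.ext.map φ⟩ : Edge) : List Edge) : Multiset Edge)
  ext := g.ext

/-! ### Grammars -/

/-- A hyperedge replacement grammar: its start graph and its rules `(A, rhs A)`.  The nonterminals
are the left-hand sides of the rules. -/
structure Grammar where
  start : HGraph
  rules : Multiset (Symb × HGraph)

/-- The grammar without nonterminals whose start graph is `g`. -/
def Grammar.ofGraph (g : HGraph) : Grammar := ⟨g, 0⟩

/-- The size of a grammar: the sum of the sizes of all right-hand sides, including the start
graph. -/
def Grammar.size (G : Grammar) : ℕ := G.start.size + (G.rules.map fun p => p.2.size).sum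

/-- The number of edges with label `A` in the whole grammar. -/
def Grammar.ref (G : Grammar) (A : Symb) : ℕ :=
  G.start.countLab A + (G.rules.map fun p => p.2.countLab A).sum

/-- The symbol `A` does not occur in the grammar. -/
def Grammar.IsFresh (G : Grammar) (A : Symb) : Prop :=
  G.ref A = 0 ∧ ∀ p ∈ G.rules, p.1 ≠ A

/-! ### The replacement loop -/

/-- One iteration of the replacement loop with maximal rank `r`. -/
def LoopStep (r : ℕ∞) (G G' : Grammar) : Prop :=
  ∃ (d : HGraph) (L : List (ℕ → ℕ)) (i : ℕ),
    IsMostFrequent r G.start d L ∧ 2 ≤ L.length ∧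
    G.IsFresh (.nonterm i d.rank) ∧
    G' = ⟨replaceOccs G.start d (.nonterm i d.rank) L, (.nonterm i d.rank, d) ::ₘ G.rules⟩

/-- `G'` is a possible result of the replacement loop started with `G`: the loop is iterated until
there is no active digram left. -/
def LoopResult (r : ℕ∞) (G G' : Grammar) : Prop :=
  Relation.ReflTransGen (LoopStep r) G G' ∧ ∀ d, ¬ IsActive r G'.start d

/-! ### Virtual edges -/

/-- Any two nodes of the graph are joined by a chain of edges. -/
def HGraph.IsConnected (g : HGraph) : Prop :=
  ∀ u ∈ g.V, ∀ v ∈ g.V,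
    Relation.ReflTransGen (fun x y => ∃ e ∈ g.E, x ∈ e.att ∧ y ∈ e.att) u v

/-- Addition of edges to a graph. -/
def HGraph.addEdges (g : HGraph) (F : Multiset Edge) : HGraph := ⟨g.V, g.E + F, g.ext⟩

/-- The components of the start graph are connected by virtual edges, without any superfluous
virtual edge.  In particular a connected start graph is left unchanged. -/
def ConnectVirtual (G G' : Grammar) : Prop :=
  ∃ F : Multiset Edge,
    (∀ e ∈ F, e.lab = .virt ∧ e.att.length = 2 ∧ e.att.Nodup ∧ ∀ v ∈ e.att, v ∈ G.start.V) ∧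
    (G.start.addEdges F).IsConnected ∧
    (∀ F' < F, ¬ (G.start.addEdges F').IsConnected) ∧
    G' = ⟨G.start.addEdges F, G.rules⟩

/-- Removal of the virtual edges from a graph. -/
def HGraph.dropVirtual (g : HGraph) : HGraph := ⟨g.V, g.E.filter fun e => e.lab ≠ .virt, g.ext⟩

/-- Removal of the virtual edges from a grammar. -/
def Grammar.dropVirtual (G : Grammar) : Grammar :=
  ⟨G.start.dropVirtual, G.rules.map fun p => (p.1, p.2.dropVirtual)⟩

/-! ### Pruning -/

/-- `g'` is obtained from `g` by applying the rule `A → h` to one edge `e` labelled `A`: the edge `e`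
is removed and a copy of `h` is added, the external nodes of which are the nodes attached to `e`, and
the internal nodes of which are new. -/
def Derives (A : Symb) (h g g' : HGraph) : Prop :=
  ∃ (e : Edge) (ρ : ℕ → ℕ), e ∈ g.E ∧ e.lab = A ∧ Set.InjOn ρ h.V ∧ h.ext.map ρ = e.att ∧
    (∀ v ∈ h.V, v ∉ h.ext → ρ v ∉ g.V) ∧
    g' = ⟨g.V ∪ h.V.image ρ, g.E.erase e + h.E.map (Edge.rename ρ), g.ext⟩

/-- `g'` is obtained from `g` by applying the rule `A → h` to every edge labelled `A`. -/
def DerivesAll (A : Symb) (h g g' : HGraph) : Prop :=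
  Relation.ReflTransGen (Derives A h) g g' ∧ g'.countLab A = 0

/-- `G'` is obtained from `G` by removing the nonterminal `A` with right-hand side `h`: its rule is
applied to every `A`-edge of the grammar, and is then deleted. -/
def RemoveNonterminal (A : Symb) (h : HGraph) (G G' : Grammar) : Prop :=
  ∃ R : Multiset (Symb × HGraph), G.rules = (A, h) ::ₘ R ∧
    DerivesAll A h G.start G'.start ∧
    Multiset.Rel (fun p q => p.1 = q.1 ∧ DerivesAll A h p.2 q.2) R G'.rules

/-- The size of the handle of a nonterminal of rank `n`: the graph with `n` nodes, all external, and
one edge attached to them. -/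
def handleSize (n : ℕ) : ℕ := n + edgeSize n

/-- The contribution `|ref(A)| (|rhs(A)| - |handle(A)|) - |rhs(A)|` of the nonterminal `A` with
right-hand side `h`. -/
def Grammar.con (G : Grammar) (A : Symb) (h : HGraph) : ℤ :=
  (G.ref A : ℤ) * ((h.size : ℤ) - (handleSize A.rank : ℤ)) - (h.size : ℤ)

/-- Removal of one nonterminal which is referenced exactly once. -/
def PruneOnceStep (G G' : Grammar) : Prop :=
  ∃ A h, (A, h) ∈ G.rules ∧ G.ref A = 1 ∧ RemoveNonterminal A h G G'

/-- `G'` is obtained from `G` by removing nonterminals which are referenced exactly once until there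
are none left. -/
def PruneOnce (G G' : Grammar) : Prop :=
  Relation.ReflTransGen PruneOnceStep G G' ∧ ∀ p ∈ G'.rules, G'.ref p.1 ≠ 1

/-- `l` lists the nonterminals of `G` bottom-up: the right-hand side of a nonterminal refers only to
nonterminals which precede it in the list. -/
def IsBottomUp (G : Grammar) (l : List Symb) : Prop :=
  (l : Multiset Symb) = G.rules.map Prod.fst ∧
  l.Pairwise fun A B => ∀ h, (A, h) ∈ G.rules → h.countLab B = 0 ∧ A ≠ B

/-- The nonterminals in the list are visited one after the other, and each nonterminal the
contribution of which is not positive at that moment is removed. -/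
inductive PruneTraverse : List Symb → Grammar → Grammar → Prop
  | done (G : Grammar) : PruneTraverse [] G G
  | remove {A : Symb} {l : List Symb} {h : HGraph} {G G' G'' : Grammar} :
      (A, h) ∈ G.rules → G.con A h ≤ 0 → RemoveNonterminal A h G G' →
      PruneTraverse l G' G'' → PruneTraverse (A :: l) G G''
  | keep {A : Symb} {l : List Symb} {h : HGraph} {G G' : Grammar} :
      (A, h) ∈ G.rules → 0 < G.con A h →
      PruneTraverse l G G' → PruneTraverse (A :: l) G G'

/-- The pruning step: first the nonterminals which are referenced exactly once are removed, then the
remaining nonterminals are traversed bottom-up and those which do not contribute are removed. -/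
def Prune (G G' : Grammar) : Prop :=
  ∃ (G₁ : Grammar) (l : List Symb), PruneOnce G G₁ ∧ IsBottomUp G₁ l ∧ PruneTraverse l G₁ G'

/-! ### The compressor -/

/-- `G` is a possible output of gRePair with maximal rank `r` on the graph `g`: replacement loop,
connection of the components by virtual edges, second run of the replacement loop, pruning, removal
of the virtual edges.  All choices which the algorithm leaves open are left open. -/
def IsOutput (r : ℕ∞) (g : HGraph) (G : Grammar) : Prop :=
  ∃ G₁ G₂ G₃ G₄ : Grammar,
    LoopResult r (Grammar.ofGraph g) G₁ ∧ ConnectVirtual G₁ G₂ ∧ LoopResult r G₂ G₃ ∧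
    Prune G₃ G₄ ∧ G = G₄.dropVirtual

/-! ### Trees and tree-graphs -/

/-- Ordered trees, the nodes of which are labelled by names of symbols.  The rank of the symbol at a
node is its number of children. -/
inductive OrdTree where
  | node (label : ℕ) (children : List OrdTree) : OrdTree

mutual
/-- The number of nodes of a tree. -/
def OrdTree.numNodes : OrdTree → ℕ
  | .node _ cs => 1 + OrdTree.numNodesList cs
/-- The number of nodes of a forest. -/
def OrdTree.numNodesList : List OrdTree → ℕ
  | [] => 0
  | c :: cs => OrdTree.numNodes c + OrdTree.numNodesList cs
end

/-- The positions of the roots of the trees of a forest, if the nodes of the forest are numbered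
consecutively in lexicographical order of their addresses (that is, in pre-order) starting with
`s`. -/
def OrdTree.rootPositions : List OrdTree → ℕ → List ℕ
  | [], _ => []
  | c :: cs, s => s :: OrdTree.rootPositions cs (s + c.numNodes)

mutual
/-- The edges of the tree-graph of a tree, the nodes of which are numbered in pre-order starting with
`s`.  A tree node with `k` children becomes an edge of rank `k + 1`, attached to the tree node and
then to its children from left to right. -/
def OrdTree.graphEdges : OrdTree → ℕ → Multiset Edge
  | .node a cs, s =>
    ⟨.term a (cs.length + 1), s :: OrdTree.rootPositions cs (s + 1)⟩ ::ₘ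
      OrdTree.graphEdgesList cs (s + 1)
/-- The edges of the tree-graphs of the trees of a forest. -/
def OrdTree.graphEdgesList : List OrdTree → ℕ → Multiset Edge
  | [], _ => 0
  | c :: cs, s => OrdTree.graphEdges c s + OrdTree.graphEdgesList cs (s + c.numNodes)
end

/-- The tree-graph of a tree.  Its nodes are the positions of the tree nodes in pre-order, and its
only external node is the root. -/
def OrdTree.tGraph (t : OrdTree) : HGraph := ⟨Finset.range t.numNodes, t.graphEdges 0, [0]⟩

/-- The right comb with `m` nodes labelled `f` (name `1`), each with `k` children: the first `k - 1`
children are leaves labelled `a` (name `0`), and the last child is the next `f`-labelled node, except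
for the last `f`-labelled node, which has only `a`-labelled children. -/
def comb (k : ℕ) : ℕ → OrdTree
  | 0 => .node 0 []
  | m + 1 => .node 1 (List.replicate (k - 1) (.node 0 []) ++ [comb k m])

/-- The tree-graph of the right comb with `2 ^ n` nodes labelled `f_k`. -/
def combGraph (n k : ℕ) : HGraph := (comb k (2 ^ n)).tGraph

end GRePair

-- The tree-graph of the comb is a spine: `2 ^ n` translates of one edge of rank `k + 1`,
-- consecutive ones sharing a node, with a unary leaf edge at every other node except the root
-- (`tGraph_comb_eq_spineGraph`). Spine graphs `spineGraph m K Z π` are closed under the replacement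
-- loop. The offset sequence `π` may be in any order, since the external nodes of a digram may be
-- listed in any order.
--
-- In a spine graph every node is attached to two edges, or is the root and attached to one. The
-- internal nodes of an occurrence are therefore exactly the nodes shared by its two edges
-- (`HGraph.IsThin.isOccurrence_iff`). An occurrence consists of a spine edge and a leaf edge, or of
-- two consecutive spine edges. A leaf at a fixed interior offset gives `m` disjoint occurrences,
-- two spine edges at most `m / 2`. So while `π` has an interior offset, the loop must absorb one
-- leaf position in all spine edges at once, which shortens `π` by one and costs a rule of size
-- `O(|π|)`; this sums to `O(k ^ 2)`. When only the offsets `0` and `K` remain, the spine is a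
-- string of length `2 ^ j`. A maximum set of disjoint consecutive pairs is then a perfect matching,
-- and replacement halves the length at constant cost, in at most `n` rounds.
--
-- `LoopStep.exists_spineGraph` records this as a decrease of the potential `(|π| + 2) ^ 2 + 10 * j`
-- by at least the size of the new rule, and `le_one_of_not_isActive` shows that at most two spine
-- edges are left at the end. The start graph stays connected, so no virtual edges arise and the
-- second run of the loop is idle. Pruning never enlarges the grammar (`Prune.size_le`), because
-- removing a nonterminal changes the size by at most its contribution.
--
-- For a maximal rank below `k`: every occurrence contains a spine edge, whose `k + 1` nodes are all
-- external in the digram except the shared one, so the digram has rank at least `k`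
-- (`length_le_rank_of_isOccurrence`). No digram is ever admissible.

namespace GRePair

/-! ### Sound graphs and applications of a rule -/

/-- The edges of the graph are attached to nodes of the graph, without repetition, and in accordance
with the ranks of their labels. -/
structure HGraph.Sound (g : HGraph) : Prop where
  att_subset : ∀ e ∈ g.E, ∀ v ∈ e.att, v ∈ g.V
  att_nodup : ∀ e ∈ g.E, e.att.Nodup
  rank_lab : ∀ e ∈ g.E, e.rank = e.lab.rank

/-- The rule `A → h` is well-formed and not recursive. -/
structure SoundRule (A : Symb) (h : HGraph) : Prop where
  sound : h.Sound
  ext_subset : ∀ v ∈ h.ext, v ∈ h.V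
  ext_nodup : h.ext.Nodup
  rank_eq : h.rank = A.rank
  countLab_self : h.countLab A = 0

lemma HGraph.IsHypergraph.sound {g : HGraph} (hg : g.IsHypergraph) : g.Sound :=
  ⟨hg.att_subset, hg.att_nodup, hg.rank_lab⟩

@[simp] lemma Edge.rename_lab (ρ : ℕ → ℕ) (e : Edge) : (e.rename ρ).lab = e.lab := rfl

@[simp] lemma Edge.rename_att (ρ : ℕ → ℕ) (e : Edge) : (e.rename ρ).att = e.att.map ρ := rfl

@[simp] lemma Edge.rename_rank (ρ : ℕ → ℕ) (e : Edge) : (e.rename ρ).rank = e.rank := by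
  simp [Edge.rank]

lemma HGraph.countLab_eq_countP (g : HGraph) (A : Symb) :
    g.countLab A = g.E.countP fun e => e.lab = A := by
  rw [HGraph.countLab, Multiset.countP_eq_card_filter]

lemma HGraph.countLab_eq_zero {g : HGraph} {A : Symb} :
    g.countLab A = 0 ↔ ∀ e ∈ g.E, e.lab ≠ A := by
  rw [countLab_eq_countP, Multiset.countP_eq_zero]

lemma countP_map_rename (ρ : ℕ → ℕ) (E : Multiset Edge) (A : Symb) :
    (E.map (Edge.rename ρ)).countP (fun e => e.lab = A) = E.countP fun e => e.lab = A := by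
  rw [Multiset.countP_map, Multiset.countP_eq_card_filter]; rfl

section Derives

variable {A : Symb} {h g g' : HGraph}

lemma Derives.ext_eq (hd : Derives A h g g') : g'.ext = g.ext := by
  obtain ⟨e, ρ, -, -, -, -, -, rfl⟩ := hd; rfl

lemma Derives.countLab_add (hd : Derives A h g g') (B : Symb) :
    g'.countLab B + (if A = B then 1 else 0) = g.countLab B + h.countLab B := by
  obtain ⟨e, ρ, he, hA, -, -, -, rfl⟩ := hd
  obtain ⟨R, hR⟩ := Multiset.exists_cons_of_mem he
  simp only [HGraph.countLab_eq_countP, hR, Multiset.erase_cons_head, Multiset.countP_add,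
    countP_map_rename, Multiset.countP_cons, hA]
  split_ifs <;> omega

lemma Derives.sound (hr : SoundRule A h) (hg : g.Sound) (hd : Derives A h g g') : g'.Sound := by
  obtain ⟨e, ρ, he, hA, hinj, hext, hnew, rfl⟩ := hd
  refine ⟨?_, ?_, ?_⟩ <;> intro f hf <;>
    rcases Multiset.mem_add.1 hf with hf | hf
  · exact fun v hv => Finset.mem_union_left _ (hg.att_subset f (Multiset.mem_of_mem_erase hf) v hv)
  · obtain ⟨f, hf', rfl⟩ := Multiset.mem_map.1 hf
    intro v hv
    obtain ⟨u, hu, rfl⟩ := List.mem_map.1 hv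
    exact Finset.mem_union_right _ (Finset.mem_image_of_mem _ (hr.sound.att_subset f hf' u hu))
  · exact hg.att_nodup f (Multiset.mem_of_mem_erase hf)
  · obtain ⟨f, hf', rfl⟩ := Multiset.mem_map.1 hf
    exact (hr.sound.att_nodup f hf').map_on fun x hx y hy hxy =>
      hinj (hr.sound.att_subset f hf' x hx) (hr.sound.att_subset f hf' y hy) hxy
  · exact hg.rank_lab f (Multiset.mem_of_mem_erase hf)
  · obtain ⟨f, hf', rfl⟩ := Multiset.mem_map.1 hf
    simpa using hr.sound.rank_lab f hf'

/-- What is saved against a disjoint union with `h` is one handle: the edge that disappears and the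
nodes on which the external nodes of `h` are placed. -/
lemma Derives.size_le (hr : SoundRule A h) (hg : g.Sound) (hd : Derives A h g g') :
    g'.size + handleSize A.rank ≤ g.size + h.size := by
  obtain ⟨e, ρ, he, hA, hinj, hext, hnew, rfl⟩ := hd
  have hrank : e.rank = A.rank := by rw [hg.rank_lab e he, hA]
  have hatt := hg.att_subset e he
  obtain ⟨R, hR⟩ := Multiset.exists_cons_of_mem he
  have hsub : h.ext.toFinset ⊆ h.V := fun v hv => hr.ext_subset v (List.mem_toFinset.1 hv)
  have hcard : (h.V \ h.ext.toFinset).card + A.rank = h.V.card := by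
    rw [← hr.rank_eq, HGraph.rank, ← List.toFinset_card_of_nodup hr.ext_nodup]
    exact Finset.card_sdiff_add_card_eq_card hsub
  -- External nodes of the copy land on nodes attached to `e`, which `g` already has; only internal
  -- nodes can add to the count.
  have hV : g.V ∪ h.V.image ρ ⊆ g.V ∪ (h.V \ h.ext.toFinset).image ρ := by
    intro v hv
    rcases Finset.mem_union.1 hv with hv | hv
    · exact Finset.mem_union_left _ hv
    · obtain ⟨u, hu, rfl⟩ := Finset.mem_image.1 hv
      by_cases hue : u ∈ h.ext
      · refine Finset.mem_union_left _ (hatt _ ?_)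
        rw [← hext]
        exact List.mem_map_of_mem hue
      · exact Finset.mem_union_right _ (Finset.mem_image_of_mem _ (by simp [hu, hue]))
  have h1 := (Finset.card_le_card hV).trans ((Finset.card_union_le _ _).trans
    (Nat.add_le_add_left Finset.card_image_le _))
  have h2 : (h.E.map (Edge.rename ρ)).map (fun e => edgeSize e.rank) =
      h.E.map fun e => edgeSize e.rank := by
    rw [Multiset.map_map]; exact Multiset.map_congr rfl fun x _ => by simp
  simp only [HGraph.size, handleSize, hR, Multiset.erase_cons_head, Multiset.map_add, h2,
    Multiset.sum_add, Multiset.map_cons, Multiset.sum_cons, hrank]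
  omega

lemma exists_derives (hr : SoundRule A h) (hg : g.Sound) (hA : g.countLab A ≠ 0) :
    ∃ g', Derives A h g g' := by
  rw [Ne, HGraph.countLab_eq_zero] at hA
  push Not at hA
  obtain ⟨e, he, hA⟩ := hA
  have hlen : h.ext.length = e.att.length := by
    have := hr.rank_eq
    rw [← hA, ← hg.rank_lab e he] at this
    exact this
  have hM : ∀ v ∈ g.V, v < g.V.sup id + 1 := fun v hv =>
    Nat.lt_succ_of_le (Finset.le_sup (f := id) hv)
  set M := g.V.sup id + 1
  -- External nodes go to the attachment of `e` (the default `0` is never reached, as the lengths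
  -- agree); internal nodes are shifted beyond every node of `g`.
  let ρ : ℕ → ℕ := fun v => if v ∈ h.ext then e.att.getD (h.ext.idxOf v) 0 else v + M
  have hρ : ∀ v ∈ h.ext, ∃ hi : h.ext.idxOf v < e.att.length, ρ v = e.att[h.ext.idxOf v] := by
    intro v hv
    have hi : h.ext.idxOf v < e.att.length := hlen ▸ List.idxOf_lt_length_iff.2 hv
    refine ⟨hi, ?_⟩
    simp only [ρ, if_pos hv]
    rw [List.getD_eq_getElem _ _ hi]
  have hρM : ∀ v ∈ h.ext, ρ v < M := by
    intro v hv
    obtain ⟨hi, h1⟩ := hρ v hv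
    rw [h1]
    exact hM _ (hg.att_subset e he _ (List.getElem_mem hi))
  have hρN : ∀ v, v ∉ h.ext → ρ v = v + M := fun v hv => by simp only [ρ, if_neg hv]
  refine ⟨_, e, ρ, he, hA, ?_, ?_, ?_, rfl⟩
  · intro x _ y _ hxy
    by_cases hx : x ∈ h.ext <;> by_cases hy : y ∈ h.ext
    · obtain ⟨hi, h1⟩ := hρ x hx
      obtain ⟨hj, h2⟩ := hρ y hy
      rw [h1, h2, (hg.att_nodup e he).getElem_inj_iff] at hxy
      exact List.idxOf_inj hx |>.1 hxy
    · have := hρM x hx; have := hρN y hy; omega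
    · have := hρM y hy; have := hρN x hx; omega
    · have := hρN y hy; have := hρN x hx; omega
  · refine List.ext_getElem (by simpa using hlen) fun i h1 h2 => ?_
    simp only [List.length_map] at h1
    obtain ⟨hi, h3⟩ := hρ h.ext[i] (List.getElem_mem h1)
    simp only [List.getElem_map, h3]
    congr 1
    exact hr.ext_nodup.idxOf_getElem i h1
  · intro v _ hv hvg
    have := hM _ hvg
    rw [hρN v hv] at this
    omega

lemma DerivesAll.sound (hr : SoundRule A h) (hg : g.Sound) (hd : DerivesAll A h g g') :
    g'.Sound := by
  obtain ⟨hd, -⟩ := hd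
  induction hd with
  | refl => exact hg
  | tail _ hs ih => exact hs.sound hr ih

lemma DerivesAll.ext_eq (hd : DerivesAll A h g g') : g'.ext = g.ext := by
  obtain ⟨hd, -⟩ := hd
  induction hd with
  | refl => rfl
  | tail _ hs ih => exact hs.ext_eq.trans ih

lemma DerivesAll.V_subset (hd : DerivesAll A h g g') : g.V ⊆ g'.V := by
  obtain ⟨hd, -⟩ := hd
  induction hd with
  | refl => rfl
  | tail _ hs ih =>
    obtain ⟨e, ρ, -, -, -, -, -, rfl⟩ := hs
    exact ih.trans Finset.subset_union_left

lemma DerivesAll.eq_of_countLab_eq_zero (hd : DerivesAll A h g g') (hA : g.countLab A = 0) :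
    g' = g := by
  rcases Relation.ReflTransGen.cases_head hd.1 with h1 | ⟨g₁, h1, -⟩
  · exact h1.symm
  · obtain ⟨e, ρ, he, hl, -⟩ := h1
    exact absurd hl (HGraph.countLab_eq_zero.1 hA e he)

/-- The condition on `h` is needed only if the rule is applied at all; `RemoveNonterminal.sound`
depends on this conditional form. -/
lemma DerivesAll.countLab_eq_zero (hd : DerivesAll A h g g') {B : Symb} (hB : g.countLab B = 0)
    (hAB : g.countLab A ≠ 0 → h.countLab B = 0) : g'.countLab B = 0 := by
  by_cases hA : g.countLab A = 0
  · rw [hd.eq_of_countLab_eq_zero hA, hB]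
  · obtain ⟨hd, -⟩ := hd
    have hAB := hAB hA
    induction hd with
    | refl => exact hB
    | tail _ hs ih => have := hs.countLab_add B; omega

/-- Since `h` contains no `A`, each application uses up exactly one `A`-edge, so the size plus the
weighted number of pending `A`-edges never increases. The weight may be negative, hence the
integers. -/
lemma DerivesAll.size_le (hr : SoundRule A h) (hg : g.Sound) (hd : DerivesAll A h g g') :
    (g'.size : ℤ) ≤ g.size + g.countLab A * ((h.size : ℤ) - handleSize A.rank) := by
  obtain ⟨hd, hA⟩ := hd
  have key : (g'.size : ℤ) + g'.countLab A * ((h.size : ℤ) - handleSize A.rank) ≤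
      g.size + g.countLab A * ((h.size : ℤ) - handleSize A.rank) ∧ g'.Sound := by
    clear hA
    induction hd with
    | refl => exact ⟨le_rfl, hg⟩
    | @tail b c _ hs ih =>
      refine ⟨le_trans ?_ ih.1, hs.sound hr ih.2⟩
      have h1 := hs.size_le hr ih.2
      have h2 := hs.countLab_add A
      rw [if_pos rfl, hr.countLab_self] at h2
      have h3 : (b.countLab A : ℤ) = c.countLab A + 1 := by omega
      rw [h3]
      zify at h1
      linarith
  simpa [hA] using key.1

lemma exists_derivesAll (hr : SoundRule A h) (hg : g.Sound) : ∃ g', DerivesAll A h g g' := by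
  induction hn : g.countLab A generalizing g with
  | zero => exact ⟨g, .refl, hn⟩
  | succ n ih =>
    obtain ⟨g₁, h1⟩ := exists_derives hr hg (by omega)
    have h2 := h1.countLab_add A
    rw [if_pos rfl, hr.countLab_self] at h2
    obtain ⟨g₂, h3, h4⟩ := ih (h1.sound hr hg) (by omega)
    exact ⟨g₂, .head h1 h3, h4⟩

end Derives

/-! ### Sound grammars and pruning -/

/-- The right-hand sides of the grammar are sound, and the nonterminals can be ordered bottom-up. -/
structure Grammar.Sound (G : Grammar) : Prop where
  start : G.start.Sound
  rules : ∀ p ∈ G.rules, SoundRule p.1 p.2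
  order : ∃ l, IsBottomUp G l

lemma Grammar.Sound.ofGraph {g : HGraph} (hg : g.Sound) : (Grammar.ofGraph g).Sound :=
  ⟨hg, by simp [Grammar.ofGraph], [], by simp [IsBottomUp, Grammar.ofGraph]⟩

lemma IsBottomUp.nodup {G : Grammar} {l : List Symb} (hl : IsBottomUp G l) : l.Nodup := by
  refine List.Pairwise.imp_of_mem ?_ hl.2
  intro A B hA _ h
  have : A ∈ G.rules.map Prod.fst := by rw [← hl.1]; exact hA
  obtain ⟨p, hp, rfl⟩ := Multiset.mem_map.1 this
  exact (h p.2 hp).2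

lemma IsBottomUp.mem_iff {G : Grammar} {l : List Symb} (hl : IsBottomUp G l) {A : Symb} :
    A ∈ l ↔ ∃ h, (A, h) ∈ G.rules := by
  rw [← Multiset.mem_coe, hl.1, Multiset.mem_map]
  constructor
  · rintro ⟨p, hp, rfl⟩; exact ⟨p.2, hp⟩
  · rintro ⟨h, hh⟩; exact ⟨_, hh, rfl⟩

section Remove

variable {A : Symb} {h : HGraph} {G G' : Grammar}

lemma exists_removeNonterminal (hG : G.Sound) (hA : (A, h) ∈ G.rules) :
    ∃ G', RemoveNonterminal A h G G' := by
  have hr := hG.rules _ hA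
  obtain ⟨R, hR⟩ := Multiset.exists_cons_of_mem hA
  obtain ⟨s, hs⟩ := exists_derivesAll hr hG.start
  have key : ∀ R : Multiset (Symb × HGraph), (∀ p ∈ R, p.2.Sound) →
      ∃ R' : Multiset (Symb × HGraph),
        Multiset.Rel (fun p q => p.1 = q.1 ∧ DerivesAll A h p.2 q.2) R R' := by
    intro R
    induction R using Multiset.induction with
    | empty => exact fun _ => ⟨0, .zero⟩
    | cons p R ih =>
      intro hp
      obtain ⟨R', hR'⟩ := ih fun q hq => hp q (Multiset.mem_cons_of_mem hq)
      obtain ⟨g, hg⟩ := exists_derivesAll hr (hp p (Multiset.mem_cons_self _ _))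
      exact ⟨(p.1, g) ::ₘ R', .cons ⟨rfl, hg⟩ hR'⟩
  obtain ⟨R', hR'⟩ := key R fun p hp =>
    (hG.rules p (hR ▸ Multiset.mem_cons_of_mem hp)).sound
  exact ⟨⟨s, R'⟩, R, hR, hs, hR'⟩

lemma RemoveNonterminal.map_fst (hrm : RemoveNonterminal A h G G') :
    G.rules.map Prod.fst = A ::ₘ G'.rules.map Prod.fst := by
  obtain ⟨R, hR, -, hrel⟩ := hrm
  rw [hR, Multiset.map_cons]
  congr 1
  refine Multiset.rel_eq.1 (Multiset.rel_map.2 (hrel.mono ?_))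
  exact fun p _ q _ hpq => hpq.1

lemma RemoveNonterminal.card_rules (hrm : RemoveNonterminal A h G G') :
    G.rules.card = G'.rules.card + 1 := by
  simpa using congrArg Multiset.card hrm.map_fst

lemma RemoveNonterminal.mem_rules (hrm : RemoveNonterminal A h G G') : (A, h) ∈ G.rules := by
  obtain ⟨R, hR, -⟩ := hrm
  rw [hR]; exact Multiset.mem_cons_self _ _

lemma exists_rel_left {α β : Type*} {r : α → β → Prop} {s : Multiset α} {t : Multiset β}
    (hst : Multiset.Rel r s t) {b : β} (hb : b ∈ t) : ∃ a ∈ s, r a b :=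
  Multiset.exists_mem_of_rel_of_mem (Multiset.rel_flip.2 hst) hb

/-- A bottom-up order stays bottom-up after erasing `A`: a right-hand side that receives a copy of
`h` referred to `A`, so `A` preceded its left-hand side, and `h` refers only to still earlier
nonterminals. -/
lemma RemoveNonterminal.sound (hG : G.Sound) (hrm : RemoveNonterminal A h G G') : G'.Sound := by
  have hr := hG.rules _ hrm.mem_rules
  have hmem := hrm.mem_rules
  have hfst := hrm.map_fst
  obtain ⟨l, hl⟩ := hG.order
  obtain ⟨R, hR, hs, hrel⟩ := hrm
  have hAl : A ∈ l := hl.mem_iff.2 ⟨h, hmem⟩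
  have hRG : ∀ p ∈ R, p ∈ G.rules := fun p hp => hR ▸ Multiset.mem_cons_of_mem hp
  refine ⟨hs.sound hr hG.start, ?_, l.erase A, ?_, ?_⟩
  · intro q hq
    obtain ⟨p, hp, hpq, hd⟩ := exists_rel_left hrel hq
    have hp' := hG.rules p (hRG p hp)
    rw [← hpq]
    refine ⟨hd.sound hr hp'.sound, ?_, ?_, ?_, ?_⟩
    · rw [hd.ext_eq]; exact fun v hv => hd.V_subset (hp'.ext_subset v hv)
    · rw [hd.ext_eq]; exact hp'.ext_nodup
    · rw [HGraph.rank, hd.ext_eq]; exact hp'.rank_eq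
    · refine hd.countLab_eq_zero hp'.countLab_self fun hA => ?_
      by_contra hc
      have hpl : p.1 ∈ l := hl.mem_iff.2 ⟨p.2, hRG p hp⟩
      have hne : A ≠ p.1 := by rintro h1; rw [h1] at hA; exact hA hp'.countLab_self
      have := (List.pairwise_iff_getElem.1 hl.2)
      obtain ⟨i, hi, hiA⟩ := List.getElem_of_mem hAl
      obtain ⟨j, hj, hjp⟩ := List.getElem_of_mem hpl
      -- If `h` referred to `p.1` while the rule of `p.1` refers to `A`, whichever of the two comes
      -- first in the order would refer to a later one.
      rcases lt_trichotomy i j with hij | hij | hij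
      · have h2 := this i j hi hj hij
        rw [hiA, hjp] at h2
        exact hc (h2 h hmem).1
      · subst hij; exact hne (hiA.symm.trans hjp)
      · have h2 := this j i hj hi hij
        rw [hiA, hjp] at h2
        exact hA (h2 p.2 (hRG p hp)).1
  · rw [← Multiset.coe_erase, hl.1, hfst, Multiset.erase_cons_head]
  · have hpw := List.pairwise_iff_getElem.1 hl.2
    have hpw' : (l.erase A).Pairwise fun A B => ∀ h, (A, h) ∈ G.rules → h.countLab B = 0 ∧ A ≠ B :=
      hl.2.sublist List.erase_sublist
    -- Positions in the original list are kept, so that `A`, which is absent from the erased list,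
    -- can still be compared with `B`.
    have hmid : (l.erase A).Pairwise fun C B => ∃ i j, ∃ (hi : i < l.length) (hj : j < l.length),
        i < j ∧ l[i] = C ∧ l[j] = B := by
      have : l.Pairwise fun C B => ∃ i j, ∃ (hi : i < l.length) (hj : j < l.length),
          i < j ∧ l[i] = C ∧ l[j] = B :=
        List.pairwise_iff_getElem.2 fun i j hi hj hij => ⟨i, j, hi, hj, hij, rfl, rfl⟩
      exact this.sublist List.erase_sublist
    refine List.Pairwise.imp ?_ (hpw'.and hmid)
    rintro C B ⟨hCB, i, j, hi, hj, hij, hiC, hjB⟩ f hf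
    obtain ⟨p, hp, hpq, hd⟩ := exists_rel_left hrel hf
    obtain ⟨C', f'⟩ := p
    obtain rfl : C' = C := hpq
    have h1 := hCB f' (hRG _ hp)
    refine ⟨hd.countLab_eq_zero h1.1 fun hA => ?_, h1.2⟩
    obtain ⟨a, ha, haA⟩ := List.getElem_of_mem hAl
    have hai : a < j := by
      by_contra hc
      have hia : i < a := by omega
      have h2 := hpw i a hi ha hia
      rw [hiC, haA] at h2
      exact hA (h2 f' (hRG _ hp)).1
    have h2 := hpw a j ha hj hai
    rw [haA, hjB] at h2
    exact (h2 h hmem).1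

/-- Summing the per-graph estimate over all right-hand sides gives the factor `ref A`, and dropping
the rule subtracts `h.size`: this is the contribution. -/
lemma RemoveNonterminal.size_le (hG : G.Sound) (hrm : RemoveNonterminal A h G G') :
    (G'.size : ℤ) ≤ G.size + G.con A h := by
  have hr := hG.rules _ hrm.mem_rules
  obtain ⟨R, hR, hs, hrel⟩ := hrm
  have key : ∀ R R' : Multiset (Symb × HGraph), (∀ p ∈ R, p.2.Sound) →
      Multiset.Rel (fun p q => p.1 = q.1 ∧ DerivesAll A h p.2 q.2) R R' →
      (((R'.map fun p => p.2.size).sum : ℕ) : ℤ) ≤ ((R.map fun p => p.2.size).sum : ℕ) +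
        ((R.map fun p => p.2.countLab A).sum : ℕ) * ((h.size : ℤ) - handleSize A.rank) := by
    intro R R' hp hrel
    induction hrel with
    | zero => simp
    | @cons p q R R' hpq _ ih =>
      have h1 := ih fun q hq => hp q (Multiset.mem_cons_of_mem hq)
      have h2 := hpq.2.size_le hr (hp p (Multiset.mem_cons_self _ _))
      simp only [Multiset.map_cons, Multiset.sum_cons, Nat.cast_add] at h1 ⊢
      linarith
  have h1 := key R G'.rules (fun p hp =>
    (hG.rules p (hR ▸ Multiset.mem_cons_of_mem hp)).sound) hrel
  have h2 := hs.size_le hr hG.start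
  have h3 : G.ref A = G.start.countLab A + (R.map fun p => p.2.countLab A).sum := by
    simp [Grammar.ref, hR, hr.countLab_self]
  have h4 : G.size = G.start.size + (h.size + (R.map fun p => p.2.size).sum) := by
    simp [Grammar.size, hR]
  rw [Grammar.con, h3, h4, Grammar.size]
  simp only [Nat.cast_add] at h1 h2 ⊢
  linarith

end Remove

lemma PruneOnce.sound_size_le {G G' : Grammar} (hG : G.Sound) (hp : PruneOnce G G') :
    G'.Sound ∧ G'.size ≤ G.size := by
  obtain ⟨hp, -⟩ := hp
  induction hp with
  | refl => exact ⟨hG, le_rfl⟩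
  | tail _ hs ih =>
    obtain ⟨A, h, hA, href, hrm⟩ := hs
    refine ⟨hrm.sound ih.1, le_trans ?_ ih.2⟩
    -- With a single reference the contribution is minus the size of the handle, hence never
    -- positive.
    have := hrm.size_le ih.1
    rw [Grammar.con, href] at this
    push_cast at this
    omega

lemma PruneTraverse.size_le {l : List Symb} {G G' : Grammar} (hp : PruneTraverse l G G')
    (hG : G.Sound) : G'.size ≤ G.size := by
  induction hp with
  | done => exact le_rfl
  | remove _ hc hrm _ ih => have := hrm.size_le hG; have := ih (hrm.sound hG); omega
  | keep _ _ _ ih => exact ih hG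

lemma Prune.size_le {G G' : Grammar} (hp : Prune G G') (hG : G.Sound) : G'.size ≤ G.size := by
  obtain ⟨G₁, l, h1, -, h2⟩ := hp
  have := h1.sound_size_le hG
  exact (h2.size_le this.1).trans this.2

lemma exists_pruneOnce {G : Grammar} (hG : G.Sound) : ∃ G', PruneOnce G G' := by
  induction hn : G.rules.card using Nat.strong_induction_on generalizing G with
  | _ n ih =>
    by_cases hc : ∀ p ∈ G.rules, G.ref p.1 ≠ 1
    · exact ⟨G, .refl, hc⟩
    · push Not at hc
      obtain ⟨⟨A, h⟩, hA, href⟩ := hc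
      obtain ⟨G₁, h1⟩ := exists_removeNonterminal hG hA
      obtain ⟨G₂, h2, h3⟩ := ih _ (by have := h1.card_rules; omega) (h1.sound hG) rfl
      exact ⟨G₂, .head ⟨A, h, hA, href, h1⟩ h2, h3⟩

lemma exists_pruneTraverse {l : List Symb} {G : Grammar} (hG : G.Sound) (hl : l.Nodup)
    (hlG : ∀ A ∈ l, ∃ h, (A, h) ∈ G.rules) : ∃ G', PruneTraverse l G G' := by
  induction l generalizing G with
  | nil => exact ⟨G, .done G⟩
  | cons A l ih =>
    obtain ⟨h, hA⟩ := hlG A (by simp)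
    rw [List.nodup_cons] at hl
    by_cases hc : G.con A h ≤ 0
    · obtain ⟨G₁, h1⟩ := exists_removeNonterminal hG hA
      obtain ⟨G₂, h2⟩ := ih (h1.sound hG) hl.2 (by
        intro B hB
        obtain ⟨f, hf⟩ := hlG B (by simp [hB])
        have h3 : B ∈ G.rules.map Prod.fst := Multiset.mem_map.2 ⟨_, hf, rfl⟩
        rw [h1.map_fst, Multiset.mem_cons] at h3
        rcases h3 with rfl | h3
        · exact absurd hB hl.1
        · obtain ⟨p, hp, rfl⟩ := Multiset.mem_map.1 h3
          exact ⟨p.2, hp⟩)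
      exact ⟨G₂, .remove hA hc h1 h2⟩
    · obtain ⟨G₂, h2⟩ := ih hG hl.2 fun B hB => hlG B (by simp [hB])
      exact ⟨G₂, .keep hA (not_le.1 hc) h2⟩

lemma exists_prune {G : Grammar} (hG : G.Sound) : ∃ G', Prune G G' := by
  obtain ⟨G₁, h1⟩ := exists_pruneOnce hG
  obtain ⟨l, hl⟩ := (h1.sound_size_le hG).1.order
  obtain ⟨G₂, h2⟩ := exists_pruneTraverse (h1.sound_size_le hG).1 hl.nodup
    fun A hA => hl.mem_iff.1 hA
  exact ⟨G₂, G₁, l, h1, hl, h2⟩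

/-- The pruning of a grammar without rules. -/
lemma Prune.eq_of_rules_eq_zero {G G' : Grammar} (hp : Prune G G') (hG : G.rules = 0) :
    G' = G := by
  obtain ⟨G₁, l, h1, h2, h3⟩ := hp
  obtain rfl : G = G₁ := by
    rcases Relation.ReflTransGen.cases_head h1.1 with h | ⟨G₂, ⟨A, h, hA, -⟩, -⟩
    · exact h
    · simp [hG] at hA
  have : l = [] := by simpa [hG] using h2.1
  subst this
  cases h3
  rfl

/-! ### Removal of virtual edges -/

lemma HGraph.dropVirtual_size_le (g : HGraph) : g.dropVirtual.size ≤ g.size := by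
  obtain ⟨F, hF⟩ :=
    Multiset.le_iff_exists_add.1 (Multiset.filter_le (fun e => e.lab ≠ Symb.virt) g.E)
  refine Nat.add_le_add_left ?_ _
  conv_rhs => rw [hF]
  simp [HGraph.dropVirtual]

lemma Grammar.dropVirtual_size_le (G : Grammar) : G.dropVirtual.size ≤ G.size := by
  refine Nat.add_le_add G.start.dropVirtual_size_le ?_
  simp only [Grammar.dropVirtual, Multiset.map_map]
  exact Multiset.sum_map_le_sum_map _ _ fun p _ => p.2.dropVirtual_size_le

/-! ### The replacement loop -/

lemma HGraph.IsDigram.card_occEdges {d : HGraph} (hd : d.IsDigram) (φ : ℕ → ℕ) :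
    (occEdges d φ).card = 2 := by
  obtain ⟨-, e₁, e₂, hE, -⟩ := hd
  simp [occEdges, hE]

lemma HGraph.IsDigram.card_sum_occEdges {d : HGraph} (hd : d.IsDigram) (L : List (ℕ → ℕ)) :
    (L.map (occEdges d)).sum.card = 2 * L.length := by
  induction L with
  | nil => rfl
  | cons φ L ih => simp [ih, hd.card_occEdges]; ring

lemma IsNonOverlapping.two_mul_length_le {g d : HGraph} {L : List (ℕ → ℕ)}
    (hL : IsNonOverlapping g d L) (hd : d.IsDigram) : 2 * L.length ≤ g.E.card := by
  rw [← hd.card_sum_occEdges]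
  exact Multiset.card_le_card hL.2

lemma IsMostFrequent.isActive {r : ℕ∞} {g d : HGraph} {L : List (ℕ → ℕ)}
    (h : IsMostFrequent r g d L) (hL : 2 ≤ L.length) : IsActive r g d :=
  ⟨h.1, h.2.1, L, h.2.2.1, hL⟩

/-- There are infinitely many digrams, but two edges are used per occurrence, so the numbers of
disjoint occurrences are bounded and their supremum is attained. -/
lemma IsActive.exists_isMostFrequent {r : ℕ∞} {g d : HGraph} (h : IsActive r g d) :
    ∃ d L, IsMostFrequent r g d L ∧ 2 ≤ L.length := by
  obtain ⟨hd, hr, L, hL, h2⟩ := h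
  let s : Set ℕ := {n | ∃ (d : HGraph) (L : List (ℕ → ℕ)), d.IsDigram ∧ (d.rank : ℕ∞) ≤ r ∧
    IsNonOverlapping g d L ∧ L.length = n}
  have hb : BddAbove s := by
    refine ⟨g.E.card, ?_⟩
    rintro n ⟨d, L, hd, -, hL, rfl⟩
    have := hL.two_mul_length_le hd
    omega
  have hs : L.length ∈ s := ⟨d, L, hd, hr, hL, rfl⟩
  obtain ⟨d', L', hd', hr', hL', hlen⟩ := Nat.sSup_mem ⟨_, hs⟩ hb
  refine ⟨d', L', ⟨hd', hr', hL', fun d'' L'' hd'' hr'' hL'' => ?_⟩, ?_⟩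
  · rw [hlen]; exact le_csSup hb ⟨d'', L'', hd'', hr'', hL'', rfl⟩
  · rw [hlen]; exact h2.trans (le_csSup hb hs)

lemma Grammar.exists_isFresh (G : Grammar) (n : ℕ) : ∃ i, G.IsFresh (.nonterm i n) := by
  let M : Multiset Symb := G.start.E.map Edge.lab + G.rules.map Prod.fst +
    G.rules.bind fun p => p.2.E.map Edge.lab
  have hinj : Function.Injective fun i => Symb.nonterm i n := fun i j hij => by simpa using hij
  obtain ⟨i, hi⟩ := Infinite.exists_notMem_finset (M.toFinset.preimage _ hinj.injOn)
  have hi : Symb.nonterm i n ∉ M := by simpa using hi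
  refine ⟨i, ?_, fun p hp h => hi ?_⟩
  · rw [Grammar.ref, Nat.add_eq_zero_iff, HGraph.countLab_eq_zero, Multiset.sum_eq_zero_iff]
    refine ⟨fun e he h => hi ?_, fun c hc => ?_⟩
    · simp only [M, Multiset.mem_add, Multiset.mem_map]
      exact .inl (.inl ⟨e, he, h⟩)
    · obtain ⟨p, hp, rfl⟩ := Multiset.mem_map.1 hc
      refine HGraph.countLab_eq_zero.2 fun e he h => hi ?_
      simp only [M, Multiset.mem_add, Multiset.mem_bind, Multiset.mem_map]
      exact .inr ⟨p, hp, e, he, h⟩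
  · simp only [M, Multiset.mem_add, Multiset.mem_map]
    exact .inl (.inr ⟨p, hp, h⟩)

/-- Each occurrence trades two edges for one; this makes the loop terminate. -/
lemma LoopStep.card_lt {r : ℕ∞} {G G' : Grammar} (h : LoopStep r G G') :
    G'.start.E.card < G.start.E.card := by
  obtain ⟨d, L, i, hf, h2, -, rfl⟩ := h
  have h3 := hf.2.2.1.two_mul_length_le hf.1
  simp only [replaceOccs, Multiset.card_add, Multiset.card_sub hf.2.2.1.2,
    hf.1.card_sum_occEdges, Multiset.coe_card, List.length_map]
  omega

lemma exists_loopResult (r : ℕ∞) (G : Grammar) : ∃ G', LoopResult r G G' := by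
  induction hn : G.start.E.card using Nat.strong_induction_on generalizing G with
  | _ n ih =>
    by_cases h : ∃ d, IsActive r G.start d
    · obtain ⟨d, hd⟩ := h
      obtain ⟨d, L, hf, h2⟩ := hd.exists_isMostFrequent
      obtain ⟨i, hi⟩ := G.exists_isFresh d.rank
      have hs : LoopStep r G _ := ⟨d, L, i, hf, h2, hi, rfl⟩
      obtain ⟨G', h3, h4⟩ := ih _ (hn ▸ hs.card_lt) _ rfl
      exact ⟨G', .head hs h3, h4⟩
    · exact ⟨G, .refl, fun d hd => h ⟨d, hd⟩⟩

lemma LoopResult.eq_of_not_isActive {r : ℕ∞} {G G' : Grammar} (h : LoopResult r G G')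
    (hG : ∀ d, ¬ IsActive r G.start d) : G' = G := by
  rcases Relation.ReflTransGen.cases_head h.1 with h1 | ⟨G₁, ⟨d, L, i, hf, h2, -⟩, -⟩
  · exact h1.symm
  · exact absurd (hf.isActive h2) (hG d)

lemma loopResult_self {r : ℕ∞} {G : Grammar} (hG : ∀ d, ¬ IsActive r G.start d) :
    LoopResult r G G := ⟨.refl, hG⟩

/-- The fresh nonterminal can be appended to any bottom-up order, as no earlier rule refers to it.
Its own rule is not recursive because the labels of an occurring digram already appear in the start
graph. -/
lemma LoopStep.sound {r : ℕ∞} {G G' : Grammar} (h : LoopStep r G G') (hG : G.Sound)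
    (hG' : G'.start.Sound) : G'.Sound := by
  obtain ⟨d, L, i, hf, h2, hfr, rfl⟩ := h
  set A := Symb.nonterm i d.rank
  obtain ⟨l, hl⟩ := hG.order
  obtain ⟨hfr, hlhs⟩ := hfr
  rw [Grammar.ref, Nat.add_eq_zero_iff, Multiset.sum_eq_zero_iff] at hfr
  have hself : d.countLab A = 0 := by
    obtain ⟨φ, hφ⟩ := List.exists_mem_of_length_pos (show 0 < L.length by omega)
    refine HGraph.countLab_eq_zero.2 fun e he => ?_
    exact HGraph.countLab_eq_zero.1 hfr.1 (e.rename φ)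
      (Multiset.mem_of_le (hf.2.2.1.1 φ hφ).edges_le (Multiset.mem_map_of_mem _ he))
  refine ⟨hG', ?_, l ++ [A], ?_, ?_⟩
  · intro p hp
    rcases Multiset.mem_cons.1 hp with rfl | hp
    · exact ⟨hf.1.1.sound, hf.1.1.ext_subset, hf.1.1.ext_nodup, rfl, hself⟩
    · exact hG.rules p hp
  · rw [← Multiset.coe_add, hl.1, Multiset.map_cons, add_comm]; rfl
  · rw [List.pairwise_append]
    refine ⟨?_, by simp, ?_⟩
    · refine hl.2.imp_of_mem fun {B C} hB _ h f hm => ?_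
      rcases Multiset.mem_cons.1 hm with hm | hm
      · obtain ⟨f', hf'⟩ := hl.mem_iff.1 hB
        exact absurd (congrArg Prod.fst hm) (hlhs (B, f') hf')
      · exact h f hm
    · intro B hB C hC f hm
      obtain rfl : C = A := by simpa using hC
      obtain ⟨f', hf'⟩ := hl.mem_iff.1 hB
      rcases Multiset.mem_cons.1 hm with hm | hm
      · exact absurd (congrArg Prod.fst hm) (hlhs (B, f') hf')
      · exact ⟨hfr.2 _ (Multiset.mem_map.2 ⟨_, hm, rfl⟩), hlhs (B, f') hf'⟩

/-! ### Virtual edges of connected graphs -/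

lemma HGraph.addEdges_zero (g : HGraph) : g.addEdges 0 = g := by
  simp [HGraph.addEdges]

/-- A minimal set of connecting edges for a connected graph is empty. -/
lemma connectVirtual_iff {G G' : Grammar} (hG : G.start.IsConnected) :
    ConnectVirtual G G' ↔ G' = G := by
  constructor
  · rintro ⟨F, -, -, hF, rfl⟩
    obtain rfl : F = 0 := by
      by_contra h
      exact hF 0 (bot_lt_iff_ne_bot.2 h) (by rwa [HGraph.addEdges_zero])
    rw [HGraph.addEdges_zero]
  · rintro rfl
    exact ⟨0, by simp, by rwa [HGraph.addEdges_zero], by simp, by rw [HGraph.addEdges_zero]⟩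

/-! ### Thin graphs -/

/-- In a thin graph, each node which is attached to an edge is attached to exactly two edges, or is
external and attached to exactly one edge. -/
structure HGraph.IsThin (g : HGraph) : Prop where
  nodup : g.E.Nodup
  exists_other : ∀ e ∈ g.E, ∀ v ∈ e.att, v ∈ g.ext ∨ ∃ e' ∈ g.E, e' ≠ e ∧ v ∈ e'.att
  of_shared : ∀ e₁ ∈ g.E, ∀ e₂ ∈ g.E, e₁ ≠ e₂ → ∀ v, v ∈ e₁.att → v ∈ e₂.att →
    v ∉ g.ext ∧ ∀ e₃ ∈ g.E, v ∈ e₃.att → e₃ = e₁ ∨ e₃ = e₂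

lemma occEdges_eq_pair {d : HGraph} {e₁ e₂ : Edge} (hE : d.E = {e₁, e₂}) (φ : ℕ → ℕ) :
    occEdges d φ = {e₁.rename φ, e₂.rename φ} := by
  simp [occEdges, hE]

lemma pair_le_iff_of_nodup {α : Type*} {s : Multiset α} (hs : s.Nodup) {a b : α} :
    ({a, b} : Multiset α) ≤ s ↔ a ≠ b ∧ a ∈ s ∧ b ∈ s := by
  constructor
  · intro h
    have h1 := Multiset.nodup_of_le h hs
    exact ⟨by simpa using h1, Multiset.mem_of_le h (by simp), Multiset.mem_of_le h (by simp)⟩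
  · rintro ⟨h1, h2, h3⟩
    rw [Multiset.le_iff_subset (by simpa using h1)]
    intro x hx
    simp only [Multiset.insert_eq_cons, Multiset.mem_cons, Multiset.mem_singleton] at hx
    rcases hx with rfl | rfl <;> assumption

/-- In a thin graph, the internal nodes of an occurrence of a digram are those which are attached to
both edges. -/
lemma HGraph.IsThin.isOccurrence_iff {g d : HGraph} (hg : g.IsThin) (hd : d.IsHypergraph)
    {e₁ e₂ : Edge} (hE : d.E = {e₁, e₂}) (hcov : ∀ v ∈ d.V, v ∈ e₁.att ∨ v ∈ e₂.att)
    {φ : ℕ → ℕ} :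
    IsOccurrence g d φ ↔ Set.InjOn φ d.V ∧
      (e₁.rename φ ≠ e₂.rename φ ∧ e₁.rename φ ∈ g.E ∧ e₂.rename φ ∈ g.E) ∧
      ∀ v ∈ d.V, v ∈ d.ext ↔ ¬ (v ∈ e₁.att ∧ v ∈ e₂.att) := by
  -- A shared node meets no third edge and is not external in `g`. A node on only one of the two
  -- edges is external in `g` or lies on a second edge, which is then outside the occurrence.
  have key : ∀ (_ : Set.InjOn φ d.V)
      (_ : e₁.rename φ ≠ e₂.rename φ ∧ e₁.rename φ ∈ g.E ∧ e₂.rename φ ∈ g.E), ∀ v ∈ d.V,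
      ((∃ e ∈ g.E - occEdges d φ, φ v ∈ e.att) ∨ φ v ∈ g.ext ↔
        ¬ (v ∈ e₁.att ∧ v ∈ e₂.att)) := by
    rintro hinj ⟨hne, hm1, hm2⟩ v hv
    have hmem : ∀ e ∈ d.E, φ v ∈ (e.rename φ).att ↔ v ∈ e.att := by
      intro e he
      rw [Edge.rename_att, List.mem_map]
      exact ⟨fun ⟨u, hu, h⟩ => hinj (hd.att_subset e he u hu) hv h ▸ hu, fun h => ⟨v, h, rfl⟩⟩
    rw [← hmem e₁ (by simp [hE]), ← hmem e₂ (by simp [hE])]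
    have hcov' : φ v ∈ (e₁.rename φ).att ∨ φ v ∈ (e₂.rename φ).att := by
      rw [hmem e₁ (by simp [hE]), hmem e₂ (by simp [hE])]; exact hcov v hv
    have hsub : ∀ e, e ∈ g.E - occEdges d φ ↔
        e ∈ g.E ∧ ¬ (e = e₁.rename φ ∨ e = e₂.rename φ) := by
      intro e
      rw [Multiset.mem_sub_of_nodup hg.nodup, occEdges_eq_pair hE]
      simp
    simp only [hsub]
    constructor
    · rintro h ⟨h1, h2⟩
      have := hg.of_shared _ hm1 _ hm2 hne _ h1 h2
      rcases h with ⟨e, ⟨he, he'⟩, hve⟩ | h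
      · exact he' (this.2 e he hve)
      · exact this.1 h
    · intro h
      rw [or_iff_not_imp_right]
      intro hext
      rcases hcov' with h1 | h1
      · obtain ⟨e', he', hne', hv'⟩ := (hg.exists_other _ hm1 _ h1).resolve_left hext
        refine ⟨e', ⟨he', ?_⟩, hv'⟩
        rintro (rfl | rfl)
        · exact hne' rfl
        · exact h ⟨h1, hv'⟩
      · obtain ⟨e', he', hne', hv'⟩ := (hg.exists_other _ hm2 _ h1).resolve_left hext
        refine ⟨e', ⟨he', ?_⟩, hv'⟩
        rintro (rfl | rfl)
        · exact h ⟨hv', h1⟩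
        · exact hne' rfl
  have hle : occEdges d φ ≤ g.E ↔
      e₁.rename φ ≠ e₂.rename φ ∧ e₁.rename φ ∈ g.E ∧ e₂.rename φ ∈ g.E := by
    rw [occEdges_eq_pair hE, pair_le_iff_of_nodup hg.nodup]
  constructor
  · rintro ⟨h1, h2, h3⟩
    rw [hle] at h2
    exact ⟨h1, h2, fun v hv => (h3 v hv).trans (key h1 h2 v hv)⟩
  · rintro ⟨h1, h2, h3⟩
    exact ⟨h1, hle.2 h2, fun v hv => (h3 v hv).trans (key h1 h2 v hv).symm⟩

/-- Splitting off the images of each edge turns non-overlap into a statement about two multisets of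
translation parameters. -/
lemma sum_map_occEdges {d : HGraph} {e₁ e₂ : Edge} (hE : d.E = {e₁, e₂}) (L : List (ℕ → ℕ)) :
    (L.map (occEdges d)).sum =
      (L : Multiset (ℕ → ℕ)).map (fun φ => e₁.rename φ) +
        (L : Multiset (ℕ → ℕ)).map (fun φ => e₂.rename φ) := by
  induction L with
  | nil => simp
  | cons φ L ih =>
    simp only [List.map_cons, List.sum_cons, ih, occEdges_eq_pair hE, ← Multiset.cons_coe,
      Multiset.map_cons, Multiset.insert_eq_cons, Multiset.cons_add, Multiset.singleton_add,
      Multiset.add_cons]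
    exact Multiset.cons_swap _ _ _

/-! ### Spine graphs -/

/-- The `t`-th edge of a spine with period `K`. -/
def spineEdge (K : ℕ) (Z : Symb) (π : List ℕ) (t : ℕ) : Edge := ⟨Z, π.map fun i => t * K + i⟩

/-- The edge of an `a`-labelled leaf. -/
def leafEdge (v : ℕ) : Edge := ⟨.term 0 1, [v]⟩

/-- The leaves of a spine graph. -/
def leafNodes (m K : ℕ) (π : List ℕ) : Finset ℕ :=
  ((Finset.range m ×ˢ π.toFinset).filter fun p => p.2 ≠ 0 ∧ (p.2 = K → p.1 + 1 = m)).image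
    fun p => p.1 * K + p.2

/-- A chain of `m` translates of a `Z`-labelled edge with attachment sequence `π`, consecutive ones
of which share a node, together with an `a`-labelled edge at each node, except for the first node and
for the shared nodes. -/
def spineGraph (m K : ℕ) (Z : Symb) (π : List ℕ) : HGraph where
  V := (Finset.range m ×ˢ π.toFinset).image fun p => p.1 * K + p.2
  E := (Multiset.range m).map (spineEdge K Z π) + (leafNodes m K π).val.map leafEdge
  ext := [0]

/-- The requirements on the parameters of a spine graph. -/
structure IsSpinePattern (K : ℕ) (Z : Symb) (π : List ℕ) : Prop where
  pos : 0 < K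
  nodup : π.Nodup
  zero_mem : 0 ∈ π
  last_mem : K ∈ π
  le_last : ∀ i ∈ π, i ≤ K
  rank_eq : Z.rank = π.length
  ne_leaf : Z ≠ .term 0 1

/-- With offsets in `[0, K]` the code `t * K + i` of a node is unique except that offset `K` of one
translate is offset `0` of the next. All incidence arguments for spines rest on this. -/
lemma mul_add_eq_mul_add {K t t' i i' : ℕ} (hK : 0 < K) (hi : i ≤ K) (hi' : i' ≤ K)
    (h : t * K + i = t' * K + i') :
    (t' = t ∧ i' = i) ∨ (t' = t + 1 ∧ i = K ∧ i' = 0) ∨ (t = t' + 1 ∧ i = 0 ∧ i' = K) := by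
  rcases lt_trichotomy t t' with hlt | rfl | hlt
  · obtain ⟨s, rfl⟩ := Nat.exists_eq_add_of_lt hlt
    have h1 : (t + s + 1) * K = t * K + s * K + K := by ring
    have hs : s = 0 := by
      by_contra hs
      have : 1 * K ≤ s * K := Nat.mul_le_mul_right _ (Nat.one_le_iff_ne_zero.2 hs)
      omega
    subst hs
    right; left; omega
  · left; omega
  · obtain ⟨s, rfl⟩ := Nat.exists_eq_add_of_lt hlt
    have h1 : (t' + s + 1) * K = t' * K + s * K + K := by ring
    have hs : s = 0 := by
      by_contra hs
      have : 1 * K ≤ s * K := Nat.mul_le_mul_right _ (Nat.one_le_iff_ne_zero.2 hs)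
      omega
    subst hs
    right; right; omega

/-- Offset `0` is the root or a node shared with the previous spine edge, so it carries no leaf.
Offset `K` is shared with the next spine edge, except in the last translate, where it does carry
one. -/
lemma mem_leafNodes {m K : ℕ} {π : List ℕ} {v : ℕ} :
    v ∈ leafNodes m K π ↔
      ∃ t < m, ∃ i ∈ π, i ≠ 0 ∧ (i = K → t + 1 = m) ∧ v = t * K + i := by
  simp only [leafNodes, Finset.mem_image, Finset.mem_filter, Finset.mem_product, Finset.mem_range,
    List.mem_toFinset, Prod.exists]
  constructor
  · rintro ⟨t, i, ⟨⟨h1, h2⟩, h3, h4⟩, rfl⟩; exact ⟨t, h1, i, h2, h3, h4, rfl⟩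
  · rintro ⟨t, h1, i, h2, h3, h4, rfl⟩; exact ⟨t, i, ⟨⟨h1, h2⟩, h3, h4⟩, rfl⟩

lemma mem_spineEdge {K : ℕ} {Z : Symb} {π : List ℕ} {t v : ℕ} :
    v ∈ (spineEdge K Z π t).att ↔ ∃ i ∈ π, v = t * K + i := by
  simp [spineEdge, eq_comm]

lemma mem_leafEdge {v w : ℕ} : v ∈ (leafEdge w).att ↔ v = w := by
  simp [leafEdge]

section

variable {m K : ℕ} {Z : Symb} {π : List ℕ}

lemma mem_spineGraph_V {v : ℕ} :
    v ∈ (spineGraph m K Z π).V ↔ ∃ t < m, ∃ i ∈ π, v = t * K + i := by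
  simp only [spineGraph, Finset.mem_image, Finset.mem_product, Finset.mem_range,
    List.mem_toFinset, Prod.exists]
  constructor
  · rintro ⟨t, i, ⟨h1, h2⟩, rfl⟩; exact ⟨t, h1, i, h2, rfl⟩
  · rintro ⟨t, h1, i, h2, rfl⟩; exact ⟨t, i, ⟨h1, h2⟩, rfl⟩

lemma mem_spineGraph_E {e : Edge} :
    e ∈ (spineGraph m K Z π).E ↔ (∃ t < m, e = spineEdge K Z π t) ∨
      ∃ t < m, ∃ i ∈ π, i ≠ 0 ∧ (i = K → t + 1 = m) ∧ e = leafEdge (t * K + i) := by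
  simp only [spineGraph, Multiset.mem_add, Multiset.mem_map, Multiset.mem_range, Finset.mem_val,
    mem_leafNodes]
  refine or_congr (by simp [eq_comm]) ⟨?_, ?_⟩
  · rintro ⟨v, ⟨t, h1, i, h2, h3, h4, rfl⟩, rfl⟩; exact ⟨t, h1, i, h2, h3, h4, rfl⟩
  · rintro ⟨t, h1, i, h2, h3, h4, rfl⟩; exact ⟨_, ⟨t, h1, i, h2, h3, h4, rfl⟩, rfl⟩

lemma spineEdge_injective (h : IsSpinePattern K Z π) : Function.Injective (spineEdge K Z π) := by
  intro t t' htt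
  have h1 : t * K ∈ (spineEdge K Z π t').att := by
    rw [← htt]; exact mem_spineEdge.2 ⟨0, h.zero_mem, by simp⟩
  have h2 : t' * K ∈ (spineEdge K Z π t).att := by
    rw [htt]; exact mem_spineEdge.2 ⟨0, h.zero_mem, by simp⟩
  obtain ⟨i, hi, h1⟩ := mem_spineEdge.1 h1
  obtain ⟨j, hj, h2⟩ := mem_spineEdge.1 h2
  exact Nat.eq_of_mul_eq_mul_right h.pos (by omega)

lemma leafEdge_injective : Function.Injective leafEdge := by
  intro v w h
  simpa [leafEdge] using h

lemma spineEdge_ne_leafEdge (h : IsSpinePattern K Z π) (t v : ℕ) :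
    spineEdge K Z π t ≠ leafEdge v := fun hc => h.ne_leaf (congrArg Edge.lab hc)

/-- Each non-root node lies either on two consecutive spine edges or on one spine edge and its leaf
edge; the root is external and lies on one spine edge only. -/
lemma spineGraph_isThin (h : IsSpinePattern K Z π) : (spineGraph m K Z π).IsThin := by
  refine ⟨?_, ?_, ?_⟩
  · refine Multiset.nodup_add.2 ⟨(Multiset.nodup_range m).map (spineEdge_injective h),
      (leafNodes m K π).nodup.map leafEdge_injective, Multiset.disjoint_left.2 ?_⟩
    intro e he he'
    obtain ⟨t, -, rfl⟩ := Multiset.mem_map.1 he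
    obtain ⟨v, -, hv⟩ := Multiset.mem_map.1 he'
    exact spineEdge_ne_leafEdge h t v hv.symm
  · intro e he v hv
    rcases mem_spineGraph_E.1 he with ⟨t, ht, rfl⟩ | ⟨t, ht, i, hi, hi0, hiK, rfl⟩
    · obtain ⟨i, hi, rfl⟩ := mem_spineEdge.1 hv
      by_cases hl : i ≠ 0 ∧ (i = K → t + 1 = m)
      · exact .inr ⟨leafEdge (t * K + i),
          mem_spineGraph_E.2 (.inr ⟨t, ht, i, hi, hl.1, hl.2, rfl⟩),
          (spineEdge_ne_leafEdge h _ _).symm, mem_leafEdge.2 rfl⟩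
      by_cases hi0 : i = 0
      · subst hi0
        rcases Nat.eq_zero_or_pos t with rfl | htp
        · left; simp [spineGraph]
        · obtain ⟨s, rfl⟩ := Nat.exists_eq_add_of_lt htp
          refine .inr ⟨spineEdge K Z π s, mem_spineGraph_E.2 (.inl ⟨s, by omega, rfl⟩), ?_, ?_⟩
          · intro hc; have := spineEdge_injective h hc; omega
          · exact mem_spineEdge.2 ⟨K, h.last_mem, by ring⟩
      · obtain ⟨rfl, htm⟩ : i = K ∧ t + 1 ≠ m := by
          by_contra hc
          exact hl ⟨hi0, fun hK => by_contra fun h2 => hc ⟨hK, h2⟩⟩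
        refine .inr ⟨spineEdge i Z π (t + 1), mem_spineGraph_E.2 (.inl ⟨t + 1, by omega, rfl⟩),
          ?_, ?_⟩
        · intro hc; have := spineEdge_injective h hc; omega
        · exact mem_spineEdge.2 ⟨0, h.zero_mem, by ring⟩
    · obtain rfl := mem_leafEdge.1 hv
      exact .inr ⟨spineEdge K Z π t, mem_spineGraph_E.2 (.inl ⟨t, ht, rfl⟩),
        spineEdge_ne_leafEdge h _ _, mem_spineEdge.2 ⟨i, hi, rfl⟩⟩
  · have huniq : ∀ {t t' i i'}, i ∈ π → i' ∈ π → t * K + i = t' * K + i' → _ :=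
      fun hi hi' => mul_add_eq_mul_add h.pos (h.le_last _ hi) (h.le_last _ hi')
    have hK := h.pos
    have hzz : ∀ t t' v, t ≠ t' → v ∈ (spineEdge K Z π t).att → v ∈ (spineEdge K Z π t').att →
        (∃ s, v = s * K + K ∧ ((t = s ∧ t' = s + 1) ∨ (t' = s ∧ t = s + 1))) := by
      intro t t' v hne hv hv'
      obtain ⟨i, hi, rfl⟩ := mem_spineEdge.1 hv
      obtain ⟨i', hi', hv⟩ := mem_spineEdge.1 hv'
      rcases huniq hi hi' hv with h1 | h1 | h1
      · omega
      · exact ⟨t, by rw [h1.2.1], by omega⟩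
      · exact ⟨t', by rw [hv, h1.2.2], by omega⟩
    have hzl : ∀ t' < m, ∀ i' ∈ π, i' ≠ 0 → (i' = K → t' + 1 = m) → ∀ t < m,
        t' * K + i' ∈ (spineEdge K Z π t).att → t = t' := by
      intro t' ht' i' hi' hi0 hiK t ht hv
      obtain ⟨i, hi, hv⟩ := mem_spineEdge.1 hv
      have := huniq hi' hi hv
      omega
    have hext : ∀ t i, i ∈ π → (t ≠ 0 ∨ i ≠ 0) → t * K + i ∉ (spineGraph m K Z π).ext := by
      intro t i hi hti hc
      have h0 : t * K + i = 0 := by simpa [spineGraph] using hc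
      have : t * K = 0 := by omega
      rcases Nat.mul_eq_zero.1 this with h1 | h1 <;> omega
    intro e₁ he₁ e₂ he₂ hne v hv₁ hv₂
    rw [mem_spineGraph_E] at he₁ he₂
    have hll : ∀ a b, v ∈ (leafEdge a).att → v ∈ (leafEdge b).att → leafEdge a = leafEdge b := by
      intro a b ha hb
      rw [mem_leafEdge.1 ha] at hb
      rw [mem_leafEdge.1 hb]
    rcases he₁ with ⟨t, ht, rfl⟩ | ⟨t, ht, i, hi, hi0, hiK, rfl⟩ <;>
      rcases he₂ with ⟨t', ht', rfl⟩ | ⟨t', ht', i', hi', hi0', hiK', rfl⟩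
    · have htt : t ≠ t' := fun hc => hne (by rw [hc])
      obtain ⟨s, rfl, hs⟩ := hzz t t' v htt hv₁ hv₂
      refine ⟨hext s K h.last_mem (by omega), fun e₃ he₃ hv₃ => ?_⟩
      rcases mem_spineGraph_E.1 he₃ with ⟨u, hu, rfl⟩ | ⟨u, hu, i, hi, hi0, hiK, rfl⟩
      · obtain ⟨i, hi, hv₃⟩ := mem_spineEdge.1 hv₃
        have := huniq h.last_mem hi hv₃
        have : u = t ∨ u = t' := by omega
        rcases this with rfl | rfl <;> simp
      · have := huniq h.last_mem hi (mem_leafEdge.1 hv₃)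
        omega
    · obtain rfl := mem_leafEdge.1 hv₂
      have := hzl t' ht' i' hi' hi0' hiK' t ht hv₁
      subst this
      refine ⟨hext _ _ hi' (by omega), fun e₃ he₃ hv₃ => ?_⟩
      rcases mem_spineGraph_E.1 he₃ with ⟨u, hu, rfl⟩ | ⟨u, hu, i, hi, hi0, hiK, rfl⟩
      · have := hzl t ht i' hi' hi0' hiK' u hu hv₃
        subst this
        exact .inl rfl
      · exact .inr (hll _ _ hv₃ hv₂)
    · obtain rfl := mem_leafEdge.1 hv₁
      have := hzl t ht i hi hi0 hiK t' ht' hv₂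
      subst this
      refine ⟨hext _ _ hi (by omega), fun e₃ he₃ hv₃ => ?_⟩
      rcases mem_spineGraph_E.1 he₃ with ⟨u, hu, rfl⟩ | ⟨u, hu, i', hi', hi0', hiK', rfl⟩
      · have := hzl t' ht i hi hi0 hiK u hu hv₃
        subst this
        exact .inr rfl
      · exact .inl (hll _ _ hv₃ hv₁)
    · exact absurd (hll _ _ hv₁ hv₂) hne

lemma spineGraph_isHypergraph (h : IsSpinePattern K Z π) (hm : 0 < m) :
    (spineGraph m K Z π).IsHypergraph := by
  refine ⟨⟨0, mem_spineGraph_V.2 ⟨0, hm, 0, h.zero_mem, by simp⟩⟩, ?_, ?_, ?_, ?_, ?_, ?_⟩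
  · intro e he v hv
    rcases mem_spineGraph_E.1 he with ⟨t, ht, rfl⟩ | ⟨t, ht, i, hi, -, -, rfl⟩
    · obtain ⟨i, hi, rfl⟩ := mem_spineEdge.1 hv
      exact mem_spineGraph_V.2 ⟨t, ht, i, hi, rfl⟩
    · exact mem_spineGraph_V.2 ⟨t, ht, i, hi, mem_leafEdge.1 hv⟩
  · intro e he
    rcases mem_spineGraph_E.1 he with ⟨t, ht, rfl⟩ | ⟨t, ht, i, hi, -, -, rfl⟩
    · exact h.nodup.map fun x y hxy => by simpa using hxy
    · simp [leafEdge]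
  · intro e he
    rcases mem_spineGraph_E.1 he with ⟨t, ht, rfl⟩ | ⟨t, ht, i, hi, -, -, rfl⟩
    · exact List.ne_nil_of_mem (mem_spineEdge.2 ⟨0, h.zero_mem, rfl⟩)
    · simp [leafEdge]
  · intro e he
    rcases mem_spineGraph_E.1 he with ⟨t, ht, rfl⟩ | ⟨t, ht, i, hi, -, -, rfl⟩
    · simp [spineEdge, Edge.rank, h.rank_eq]
    · simp [leafEdge, Edge.rank, Symb.rank]
  · intro v hv
    obtain rfl : v = 0 := by simpa [spineGraph] using hv
    exact mem_spineGraph_V.2 ⟨0, hm, 0, h.zero_mem, by simp⟩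
  · simp [spineGraph]

lemma spineGraph_isConnected (h : IsSpinePattern K Z π) :
    (spineGraph m K Z π).IsConnected := by
  set R := fun x y => ∃ e ∈ (spineGraph m K Z π).E, x ∈ e.att ∧ y ∈ e.att
  have hsymm : Std.Symm R := ⟨fun x y ⟨e, he, hx, hy⟩ => ⟨e, he, hy, hx⟩⟩
  have hstep : ∀ t < m, ∀ i ∈ π, R (t * K) (t * K + i) := fun t ht i hi =>
    ⟨_, mem_spineGraph_E.2 (.inl ⟨t, ht, rfl⟩), mem_spineEdge.2 ⟨0, h.zero_mem, by simp⟩,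
      mem_spineEdge.2 ⟨i, hi, rfl⟩⟩
  have hspine : ∀ t < m, Relation.ReflTransGen R 0 (t * K) := by
    intro t
    induction t with
    | zero => intro _; simpa using Relation.ReflTransGen.refl
    | succ t ih =>
      intro ht
      rw [Nat.succ_mul]
      exact (ih (by omega)).tail (hstep t (by omega) K h.last_mem)
  have hroot : ∀ v ∈ (spineGraph m K Z π).V, Relation.ReflTransGen R 0 v := by
    intro v hv
    obtain ⟨t, ht, i, hi, rfl⟩ := mem_spineGraph_V.1 hv
    exact (hspine t ht).tail (hstep t ht i hi)
  intro u hu v hv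
  exact (Relation.ReflTransGen.stdSymm.symm _ _ (hroot u hu)).trans (hroot v hv)

lemma card_leafNodes_le : (leafNodes m K π).card ≤ m * π.length := by
  refine Finset.card_image_le.trans ((Finset.card_filter_le _ _).trans ?_)
  rw [Finset.card_product, Finset.card_range]
  exact Nat.mul_le_mul_left _ (List.toFinset_card_le π)

lemma edgeSize_le (n : ℕ) : edgeSize n ≤ n + 1 := by
  unfold edgeSize; split_ifs <;> omega

lemma spineGraph_size_le : (spineGraph m K Z π).size ≤ m * (3 * π.length + 1) := by
  have h1 : (spineGraph m K Z π).V.card ≤ m * π.length := by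
    refine Finset.card_image_le.trans ?_
    rw [Finset.card_product, Finset.card_range]
    exact Nat.mul_le_mul_left _ (List.toFinset_card_le π)
  have h2 := card_leafNodes_le (m := m) (K := K) (π := π)
  have h3 := Nat.mul_le_mul_left m (edgeSize_le π.length)
  have h4 : ((spineGraph m K Z π).E.map fun e => edgeSize e.rank).sum =
      m * edgeSize π.length + (leafNodes m K π).card := by
    simp only [spineGraph, Multiset.map_add, Multiset.map_map, Function.comp_def, spineEdge,
      leafEdge, Edge.rank, List.length_map, List.length_singleton, Multiset.map_const',
      Multiset.sum_add, Multiset.sum_replicate, Multiset.card_range, smul_eq_mul]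
    simp [edgeSize]
  rw [HGraph.size, h4]
  nlinarith

end

/-! ### Occurrences of digrams in spine graphs -/

/-- `d` is a digram with edges `e₁` and `e₂`. -/
structure HGraph.IsDigramWith (d : HGraph) (e₁ e₂ : Edge) : Prop where
  isHypergraph : d.IsHypergraph
  edges : d.E = {e₁, e₂}
  cover : ∀ v ∈ d.V, v ∈ e₁.att ∨ v ∈ e₂.att
  shared : ∃ v ∈ d.V, v ∈ e₁.att ∧ v ∈ e₂.att
  ext_ne_nil : d.ext ≠ []

lemma HGraph.IsDigram.exists_with {d : HGraph} (hd : d.IsDigram) :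
    ∃ e₁ e₂, d.IsDigramWith e₁ e₂ := by
  obtain ⟨h1, e₁, e₂, h2, h3, h4, h5⟩ := hd
  exact ⟨e₁, e₂, h1, h2, h3, h4, h5⟩

section

variable {d : HGraph} {e₁ e₂ : Edge}

lemma HGraph.IsDigramWith.isDigram (hd : d.IsDigramWith e₁ e₂) : d.IsDigram :=
  ⟨hd.1, e₁, e₂, hd.2, hd.3, hd.4, hd.5⟩

lemma HGraph.IsDigramWith.symm (hd : d.IsDigramWith e₁ e₂) : d.IsDigramWith e₂ e₁ := by
  obtain ⟨h1, h2, h3, ⟨v, hv, hv1, hv2⟩, h5⟩ := hd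
  exact ⟨h1, h2.trans (Multiset.pair_comm _ _), fun v hv => (h3 v hv).symm, ⟨v, hv, hv2, hv1⟩, h5⟩

lemma HGraph.IsDigramWith.left_subset (hd : d.IsDigramWith e₁ e₂) : ∀ v ∈ e₁.att, v ∈ d.V :=
  hd.isHypergraph.att_subset e₁ (by simp [hd.edges])

lemma HGraph.IsDigramWith.exists_shared (hd : d.IsDigramWith e₁ e₂) (φ : ℕ → ℕ) :
    ∃ v, v ∈ (e₁.rename φ).att ∧ v ∈ (e₂.rename φ).att := by
  obtain ⟨v, -, h1, h2⟩ := hd.shared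
  exact ⟨φ v, List.mem_map_of_mem h1, List.mem_map_of_mem h2⟩

variable {m K : ℕ} {Z : Symb} {π : List ℕ} {φ : ℕ → ℕ}

/-- Different leaf edges have different nodes, so the two edges of an occurrence cannot both be leaf
edges. -/
lemma leaf_or_spine_of_isOccurrence (h : IsSpinePattern K Z π) (hd : d.IsDigramWith e₁ e₂)
    (hφ : IsOccurrence (spineGraph m K Z π) d φ) :
    (e₁.lab = Z ∧ e₂.lab = Z) ∨ (e₁.lab = Z ∧ e₂.lab = .term 0 1) ∨
      (e₁.lab = .term 0 1 ∧ e₂.lab = Z) := by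
  obtain ⟨-, ⟨hne, h1, h2⟩, -⟩ :=
    ((spineGraph_isThin h).isOccurrence_iff hd.isHypergraph hd.edges hd.cover).1 hφ
  obtain ⟨v, hv1, hv2⟩ := hd.exists_shared φ
  rcases mem_spineGraph_E.1 h1 with ⟨t, -, ht⟩ | ⟨t, -, i, -, -, -, ht⟩ <;>
    rcases mem_spineGraph_E.1 h2 with ⟨t', -, ht'⟩ | ⟨t', -, i', -, -, -, ht'⟩ <;>
    have h3 := congrArg Edge.lab ht <;> have h4 := congrArg Edge.lab ht'
  · exact .inl ⟨h3, h4⟩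
  · exact .inr (.inl ⟨h3, h4⟩)
  · exact .inr (.inr ⟨h3, h4⟩)
  · rw [ht, mem_leafEdge] at hv1
    rw [ht', mem_leafEdge] at hv2
    exact absurd (by rw [ht, ht', ← hv1, ← hv2]) hne

lemma IsSpinePattern.exists_of_lab_eq (h : IsSpinePattern K Z π) {e : Edge}
    (he : e ∈ (spineGraph m K Z π).E) (hl : e.lab = Z) : ∃ t < m, e = spineEdge K Z π t := by
  rcases mem_spineGraph_E.1 he with h1 | ⟨t, -, i, -, -, -, rfl⟩
  · exact h1
  · exact absurd hl.symm h.ne_leaf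

lemma exists_leaf_of_isOccurrence (h : IsSpinePattern K Z π) (hd : d.IsDigramWith e₁ e₂)
    (hφ : IsOccurrence (spineGraph m K Z π) d φ) (hl₁ : e₁.lab = Z) (hl₂ : e₂.lab = .term 0 1) :
    ∃ t < m, ∃ i ∈ π, i ≠ 0 ∧ (i = K → t + 1 = m) ∧ e₁.rename φ = spineEdge K Z π t ∧
      e₂.rename φ = leafEdge (t * K + i) := by
  obtain ⟨-, ⟨hne, h1, h2⟩, -⟩ :=
    ((spineGraph_isThin h).isOccurrence_iff hd.isHypergraph hd.edges hd.cover).1 hφ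
  obtain ⟨v, hv1, hv2⟩ := hd.exists_shared φ
  obtain ⟨t, ht, h3⟩ := h.exists_of_lab_eq h1 hl₁
  rcases mem_spineGraph_E.1 h2 with ⟨t', -, ht'⟩ | ⟨t', ht', i', hi', hi0, hiK, h4⟩
  · have := congrArg Edge.lab ht'
    exact absurd (this.symm.trans hl₂) h.ne_leaf
  · rw [h3] at hv1
    rw [h4, mem_leafEdge] at hv2
    obtain ⟨i, hi, hv1⟩ := mem_spineEdge.1 hv1
    have := mul_add_eq_mul_add h.pos (h.le_last _ hi) (h.le_last _ hi') (hv1.symm.trans hv2)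
    have hK := h.pos
    obtain rfl : t' = t := by omega
    exact ⟨t', ht, i', hi', hi0, hiK, h3, h4⟩

lemma exists_spine_of_isOccurrence (h : IsSpinePattern K Z π) (hd : d.IsDigramWith e₁ e₂)
    (hφ : IsOccurrence (spineGraph m K Z π) d φ) (hl₁ : e₁.lab = Z) (hl₂ : e₂.lab = Z) :
    ∃ t, t + 1 < m ∧
      ((e₁.rename φ = spineEdge K Z π t ∧ e₂.rename φ = spineEdge K Z π (t + 1)) ∨
        (e₂.rename φ = spineEdge K Z π t ∧ e₁.rename φ = spineEdge K Z π (t + 1))) := by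
  obtain ⟨-, ⟨hne, h1, h2⟩, -⟩ :=
    ((spineGraph_isThin h).isOccurrence_iff hd.isHypergraph hd.edges hd.cover).1 hφ
  obtain ⟨v, hv1, hv2⟩ := hd.exists_shared φ
  obtain ⟨t, ht, h3⟩ := h.exists_of_lab_eq h1 hl₁
  obtain ⟨t', ht', h4⟩ := h.exists_of_lab_eq h2 hl₂
  rw [h3] at hv1
  rw [h4] at hv2
  obtain ⟨i, hi, hv1⟩ := mem_spineEdge.1 hv1
  obtain ⟨i', hi', hv2⟩ := mem_spineEdge.1 hv2
  rcases mul_add_eq_mul_add h.pos (h.le_last _ hi) (h.le_last _ hi') (hv1.symm.trans hv2) with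
    h5 | h5 | h5
  · exact absurd (by rw [h3, h4, h5.1]) hne
  · obtain ⟨rfl, -⟩ := h5
    exact ⟨t, ht', .inl ⟨h3, h4⟩⟩
  · obtain ⟨rfl, -⟩ := h5
    exact ⟨t', ht, .inr ⟨h4, h3⟩⟩

/-- `ψ` reads off the offset of each node of `e` in the pattern. Since the attachment order is
preserved, mapping `e` onto the `t`-th spine edge leaves no freedom beyond this translation. -/
lemma rename_eq_spineEdge_iff {e : Edge} {ψ : ℕ → ℕ} (hψ : e.rename ψ = ⟨Z, π⟩) {t : ℕ} :
    e.rename φ = spineEdge K Z π t ↔ ∀ v ∈ e.att, φ v = t * K + ψ v := by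
  have h1 : e.lab = Z := congrArg Edge.lab hψ
  have h2 : e.att.map ψ = π := congrArg Edge.att hψ
  rw [← h1, ← h2, spineEdge, Edge.rename, List.map_map, Edge.mk.injEq, List.map_inj_left]
  simp

/-- The occurrences in a spine graph of a digram which consists of a spine edge and a leaf edge are
translates of each other. -/
lemma exists_leaf_translation (h : IsSpinePattern K Z π) (hd : d.IsDigramWith e₁ e₂)
    (hφ : IsOccurrence (spineGraph m K Z π) d φ) (hl₁ : e₁.lab = Z) (hl₂ : e₂.lab = .term 0 1) :
    ∃ (ψ : ℕ → ℕ) (i : ℕ), i ∈ π ∧ i ≠ 0 ∧ e₁.rename ψ = ⟨Z, π⟩ ∧ e₂.rename ψ = leafEdge i ∧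
      ∀ φ, IsOccurrence (spineGraph m K Z π) d φ →
        ∃ t < m, (i = K → t + 1 = m) ∧ ∀ v ∈ d.V, φ v = t * K + ψ v := by
  obtain ⟨t₀, ht₀, i, hi, hi0, hiK, h1, h2⟩ := exists_leaf_of_isOccurrence h hd hφ hl₁ hl₂
  obtain ⟨u, hu⟩ : ∃ u, e₂.att = [u] := by
    have := congrArg (List.length ∘ Edge.att) h2
    simpa [leafEdge, List.length_eq_one_iff] using this
  have hφu : φ u = t₀ * K + i := by
    have := congrArg Edge.att h2
    simpa [leafEdge, hu] using this
  obtain ⟨w, -, hw1, hw2⟩ := hd.shared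
  obtain rfl : w = u := by simpa [hu] using hw2
  have hsub : ∀ v ∈ d.V, v ∈ e₁.att := by
    intro v hv
    rcases hd.cover v hv with h3 | h3
    · exact h3
    · rw [hu, List.mem_singleton] at h3; rwa [h3]
  -- The truncated subtraction is harmless: every node of `d` lies on `e₁`, where `φ` takes values
  -- at least `t₀ * K`.
  have hψ : e₁.rename (fun v => φ v - t₀ * K) = ⟨Z, π⟩ := by
    have h3 : e₁.att.map φ = π.map fun i => t₀ * K + i := congrArg Edge.att h1
    have h4 := congrArg (List.map fun v => v - t₀ * K) h3
    rw [List.map_map, List.map_map] at h4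
    simp only [Function.comp_def, Nat.add_sub_cancel_left, List.map_id'] at h4
    rw [Edge.rename, hl₁, h4]
  refine ⟨fun v => φ v - t₀ * K, i, hi, hi0, hψ, ?_, fun φ' hφ' => ?_⟩
  · rw [Edge.rename, hl₂, hu, List.map_singleton, hφu, Nat.add_sub_cancel_left, leafEdge]
  · obtain ⟨t, ht, i', hi', hi0', hiK', h3, h4⟩ := exists_leaf_of_isOccurrence h hd hφ' hl₁ hl₂
    have h5 := (rename_eq_spineEdge_iff hψ).1 h3
    have h6 : φ' w = t * K + i' := by
      have := congrArg Edge.att h4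
      simpa [leafEdge, hu] using this
    -- The leaf node also lies on `e₁`, so its offset is the same in all occurrences.
    have h7 := h5 w hw1
    rw [hφu, Nat.add_sub_cancel_left, h6] at h7
    obtain rfl : i' = i := by omega
    exact ⟨t, ht, hiK', fun v hv => h5 v (hsub v hv)⟩

/-- The occurrences in a spine graph of a digram which consists of two spine edges are translates of
each other. -/
lemma exists_spine_translation (h : IsSpinePattern K Z π) (hd : d.IsDigramWith e₁ e₂)
    (hφ : IsOccurrence (spineGraph m K Z π) d φ) (hl₁ : e₁.lab = Z) (hl₂ : e₂.lab = Z) :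
    ∃ (e₁ e₂ : Edge) (ψ : ℕ → ℕ), d.IsDigramWith e₁ e₂ ∧ e₁.rename ψ = ⟨Z, π⟩ ∧
      e₂.rename ψ = ⟨Z, π.map fun i => K + i⟩ ∧
      ∀ φ, IsOccurrence (spineGraph m K Z π) d φ →
        ∃ t, t + 1 < m ∧ ∀ v ∈ d.V, φ v = t * K + ψ v := by
  -- The two edges carry the same label and are unordered in `d`; they are named so that `e₁` is the
  -- upper one in the given occurrence.
  wlog hor : ∃ t, t + 1 < m ∧ e₁.rename φ = spineEdge K Z π t ∧
      e₂.rename φ = spineEdge K Z π (t + 1) generalizing e₁ e₂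
  · obtain ⟨t, ht, h1 | h1⟩ := exists_spine_of_isOccurrence h hd hφ hl₁ hl₂
    · exact absurd ⟨t, ht, h1⟩ hor
    · exact this hd.symm hl₂ hl₁ ⟨t, ht, h1⟩
  obtain ⟨t₀, ht₀, h1, h2⟩ := hor
  set ψ : ℕ → ℕ := fun v => φ v - t₀ * K with hψ
  have hψ₁ : e₁.rename ψ = ⟨Z, π⟩ := by
    have h3 : e₁.att.map φ = π.map fun i => t₀ * K + i := congrArg Edge.att h1
    have h4 := congrArg (List.map fun v => v - t₀ * K) h3
    rw [List.map_map, List.map_map] at h4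
    simp only [Function.comp_def, Nat.add_sub_cancel_left, List.map_id'] at h4
    rw [Edge.rename, hl₁, h4]
  have hψ₂ : e₂.rename ψ = ⟨Z, π.map fun i => K + i⟩ := by
    have h3 : e₂.att.map φ = π.map fun i => (t₀ + 1) * K + i := congrArg Edge.att h2
    have h4 := congrArg (List.map fun v => v - t₀ * K) h3
    rw [List.map_map, List.map_map] at h4
    simp only [Function.comp_def, Nat.succ_mul, add_assoc, Nat.add_sub_cancel_left] at h4
    rw [Edge.rename, hl₂, h4]
  refine ⟨e₁, e₂, ψ, hd, hψ₁, hψ₂, fun φ' hφ' => ?_⟩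
  have hmem₂ : ∀ v ∈ e₂.att, ∃ i ∈ π, ψ v = K + i := fun v hv => by
    have h0 : e₂.att.map ψ = π.map fun i => K + i := congrArg Edge.att hψ₂
    have : ψ v ∈ π.map fun i => K + i := h0 ▸ List.mem_map_of_mem hv
    obtain ⟨i, hi, h⟩ := List.mem_map.1 this
    exact ⟨i, hi, h.symm⟩
  have hK := h.pos
  obtain ⟨t, ht, ⟨h3, h4⟩ | ⟨h3, h4⟩⟩ := exists_spine_of_isOccurrence h hd hφ' hl₁ hl₂
  · refine ⟨t, ht, fun v hv => ?_⟩
    rcases hd.cover v hv with hv | hv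
    · exact (rename_eq_spineEdge_iff hψ₁).1 h3 v hv
    · have hψ₂' : e₂.rename (fun v => ψ v - K) = ⟨Z, π⟩ := by
        have h5 : e₂.att.map ψ = π.map fun i => K + i := congrArg Edge.att hψ₂
        have h6 := congrArg (List.map fun v => v - K) h5
        rw [List.map_map, List.map_map] at h6
        simp only [Function.comp_def, Nat.add_sub_cancel_left, List.map_id'] at h6
        rw [Edge.rename, hl₂, h6]
      have h5 := (rename_eq_spineEdge_iff hψ₂').1 h4 v hv
      obtain ⟨i, -, h6⟩ := hmem₂ v hv
      rw [h5, Nat.succ_mul]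
      omega
  -- In reversed order a shared node would have image at least `(t + 2) * K`, yet lie on the `t`-th
  -- spine edge, whose nodes are at most `(t + 1) * K`.
  · exfalso
    obtain ⟨v, -, hv1, hv2⟩ := hd.shared
    have h5 := (rename_eq_spineEdge_iff hψ₁).1 h4 v hv1
    have h6 : φ' v ∈ (spineEdge K Z π t).att := by
      rw [← h3]; exact List.mem_map_of_mem hv2
    obtain ⟨j, hj, h6⟩ := mem_spineEdge.1 h6
    obtain ⟨i, -, h7⟩ := hmem₂ v hv2
    have := h.le_last _ hj
    rw [h6, Nat.succ_mul] at h5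
    omega

/-- Restricting to the label `Z` removes the leaves. Hence in a non-overlapping list the indices of
the spine edges used are distinct and below `m`. -/
lemma IsSpinePattern.le_range_of_map_le (h : IsSpinePattern K Z π) {T : Multiset ℕ}
    (hT : T.map (spineEdge K Z π) ≤ (spineGraph m K Z π).E) : T ≤ Multiset.range m := by
  have h1 := Multiset.filter_le_filter (fun e => e.lab = Z) hT
  have h2 : ∀ S : Multiset ℕ, (S.map (spineEdge K Z π)).filter (fun e => e.lab = Z) =
      S.map (spineEdge K Z π) := fun S => by
    rw [Multiset.filter_eq_self]
    intro e he
    obtain ⟨t, -, rfl⟩ := Multiset.mem_map.1 he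
    rfl
  have h3 : ((leafNodes m K π).val.map leafEdge).filter (fun e => e.lab = Z) = 0 := by
    rw [Multiset.filter_eq_nil]
    intro e he
    obtain ⟨t, -, rfl⟩ := Multiset.mem_map.1 he
    exact h.ne_leaf.symm
  rw [spineGraph, Multiset.filter_add, h2, h2, h3, add_zero] at h1
  exact (Multiset.map_le_map_iff (spineEdge_injective h)).1 h1

end

/-! ### Replacement steps in spine graphs -/

lemma HGraph.eq_of_components {g g' : HGraph} (hV : g.V = g'.V) (hE : g.E = g'.E)
    (hext : g.ext = g'.ext) : g = g' := by
  cases g; cases g'; simp_all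

section

variable {d : HGraph} {e₁ e₂ : Edge} {m K : ℕ} {Z : Symb} {π : List ℕ}

lemma HGraph.IsDigramWith.size_le (hd : d.IsDigramWith e₁ e₂) :
    d.size ≤ d.V.card + (edgeSize e₁.rank + edgeSize e₂.rank) := by
  simp [HGraph.size, hd.edges]

lemma IsSpinePattern.two_le_length (h : IsSpinePattern K Z π) : 2 ≤ π.length := by
  have hK := h.pos
  rw [← List.toFinset_card_of_nodup h.nodup, ← Finset.card_pair hK.ne]
  refine Finset.card_le_card fun x hx => ?_
  simp only [Finset.mem_insert, Finset.mem_singleton] at hx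
  rcases hx with rfl | rfl <;> simp [h.zero_mem, h.last_mem]

lemma IsSpinePattern.mem_iff_of_length_eq_two (h : IsSpinePattern K Z π) (hπ : π.length = 2)
    (i : ℕ) : i ∈ π ↔ i = 0 ∨ i = K := by
  have hsub : ({0, K} : Finset ℕ) ⊆ π.toFinset := by
    intro x hx
    simp only [Finset.mem_insert, Finset.mem_singleton] at hx
    rcases hx with rfl | rfl <;> simp [h.zero_mem, h.last_mem]
  have heq := Finset.eq_of_subset_of_card_le hsub (by
    rw [Finset.card_pair h.pos.ne]; exact (List.toFinset_card_le π).trans hπ.le)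
  rw [← List.mem_toFinset, ← heq]
  simp

lemma leafNodes_erase (hK : 0 < K) (hle : ∀ j ∈ π, j ≤ K) {π' : List ℕ} {i : ℕ} (hi : i ∈ π)
    (hi0 : i ≠ 0) (hiK : i ≠ K) (hπ' : ∀ j, j ∈ π' ↔ j ∈ π ∧ j ≠ i) :
    (leafNodes m K π).val = (Multiset.range m).map (fun t => t * K + i) +
      (leafNodes m K π').val := by
  have hinj : Function.Injective fun t => t * K + i := fun t t' htt =>
    Nat.eq_of_mul_eq_mul_right hK (Nat.add_right_cancel htt)
  refine (Multiset.Nodup.ext (leafNodes m K π).nodup (Multiset.nodup_add.2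
    ⟨(Multiset.nodup_range m).map hinj, (leafNodes m K π').nodup, ?_⟩)).2 fun v => ?_
  · rw [Multiset.disjoint_left]
    intro v hv hv'
    obtain ⟨t, ht, rfl⟩ := Multiset.mem_map.1 hv
    obtain ⟨t', ht', j, hj, hj0, hjK, hv'⟩ := mem_leafNodes.1 hv'
    have hj' := (hπ' j).1 hj
    have := mul_add_eq_mul_add hK (hle i hi) (hle j hj'.1) hv'
    have := hj'.2
    omega
  · simp only [Multiset.mem_add, Finset.mem_val, Multiset.mem_map, Multiset.mem_range,
      mem_leafNodes]
    constructor
    · rintro ⟨t, ht, j, hj, hj0, hjK, rfl⟩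
      by_cases hji : j = i
      · exact .inl ⟨t, ht, by rw [hji]⟩
      · exact .inr ⟨t, ht, j, (hπ' j).2 ⟨hj, hji⟩, hj0, hjK, rfl⟩
    · rintro (⟨t, ht, rfl⟩ | ⟨t, ht, j, hj, hj0, hjK, rfl⟩)
      · exact ⟨t, ht, i, hi, hi0, fun hc => absurd hc hiK, rfl⟩
      · exact ⟨t, ht, j, ((hπ' j).1 hj).1, hj0, hjK, rfl⟩

lemma mem_replaceOccs_V {g : HGraph} {A : Symb} {L : List (ℕ → ℕ)} {v : ℕ} :
    v ∈ (replaceOccs g d A L).V ↔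
      v ∈ g.V ∧ ¬ ∃ φ ∈ L, ∃ u ∈ d.V, u ∉ d.ext ∧ φ u = v := by
  classical
  simp only [replaceOccs, Finset.mem_filter]

/-- Replacement of a digram which consists of a spine edge and a leaf edge. -/
lemma replace_leaf_digram (h : IsSpinePattern K Z π) (hd : d.IsDigramWith e₁ e₂)
    (hl₁ : e₁.lab = Z) (hl₂ : e₂.lab = .term 0 1) {L : List (ℕ → ℕ)}
    (hL : IsNonOverlapping (spineGraph m K Z π) d L) (h2 : 2 ≤ L.length) :
    L.length ≤ m ∧ 2 < π.length ∧ d.size ≤ 2 * π.length + 2 ∧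
      (m ≤ L.length → ∀ A : Symb, A.rank = d.rank → A ≠ .term 0 1 →
        ∃ π', IsSpinePattern K A π' ∧ π'.length + 1 = π.length ∧
          replaceOccs (spineGraph m K Z π) d A L = spineGraph m K A π') := by
  obtain ⟨φ₀, hφ₀⟩ := List.exists_mem_of_length_pos (show 0 < L.length by omega)
  obtain ⟨ψ, i, hi, hi0, hψ₁, hψ₂, htr⟩ := exists_leaf_translation h hd (hL.1 φ₀ hφ₀) hl₁ hl₂
  have htr' : ∀ φ ∈ L, ∃ t, t < m ∧ (i = K → t + 1 = m) ∧ ∀ v ∈ d.V, φ v = t * K + ψ v :=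
    fun φ hφ => htr φ (hL.1 φ hφ)
  choose! τ hτm hτK hτ using htr'
  obtain ⟨u, hu⟩ : ∃ u, e₂.att = [u] := by
    have := congrArg (List.length ∘ Edge.att) hψ₂
    simpa [leafEdge, List.length_eq_one_iff] using this
  have hψu : ψ u = i := by
    have := congrArg Edge.att hψ₂
    simpa [leafEdge, hu] using this
  have hψπ : e₁.att.map ψ = π := congrArg Edge.att hψ₁
  obtain ⟨w, hud, hu₁, hw2⟩ := hd.shared
  obtain rfl : w = u := by simpa [hu] using hw2
  have hsub : ∀ v ∈ d.V, v ∈ e₁.att := by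
    intro v hv
    rcases hd.cover v hv with h3 | h3
    · exact h3
    · rw [hu, List.mem_singleton] at h3; rwa [h3]
  set M : Multiset (ℕ → ℕ) := (L : Multiset (ℕ → ℕ)) with hM
  set T : Multiset ℕ := M.map τ with hT
  have hM₁ : M.map (fun φ => e₁.rename φ) = T.map (spineEdge K Z π) := by
    rw [hT, Multiset.map_map]
    refine Multiset.map_congr rfl fun φ hφ => ?_
    exact (rename_eq_spineEdge_iff hψ₁).2 fun v hv => hτ φ hφ v (hd.left_subset v hv)
  have hM₂ : M.map (fun φ => e₂.rename φ) = T.map fun t => leafEdge (t * K + i) := by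
    rw [hT, Multiset.map_map]
    refine Multiset.map_congr rfl fun φ hφ => ?_
    simp only [Edge.rename, Function.comp_def, leafEdge, hl₂, hu, List.map_singleton,
      hτ φ hφ w hud, hψu]
  have hsum : (L.map (occEdges d)).sum =
      T.map (spineEdge K Z π) + T.map (fun t => leafEdge (t * K + i)) := by
    rw [sum_map_occEdges hd.edges, hM₁, hM₂]
  have hTm : T ≤ Multiset.range m :=
    h.le_range_of_map_le ((Multiset.le_add_right _ _).trans (hsum.symm.trans_le hL.2))
  have hTcard : T.card = L.length := by simp [hT, hM]
  have hlen : L.length ≤ m := by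
    rw [← hTcard, ← Multiset.card_range m]; exact Multiset.card_le_card hTm
  -- Offset `K` carries a leaf only in the last translate, which would allow just one occurrence.
  have hiK : i ≠ K := by
    intro hc
    have h3 : T ≤ {m - 1} := by
      rw [Multiset.le_iff_subset (Multiset.nodup_of_le hTm (Multiset.nodup_range m))]
      intro t ht
      obtain ⟨φ, hφ, rfl⟩ := Multiset.mem_map.1 ht
      have := hτK φ hφ hc
      rw [Multiset.mem_singleton]; omega
    have := Multiset.card_le_card h3
    rw [hTcard, Multiset.card_singleton] at this
    omega
  have hK := h.pos
  have h3 : 2 < π.length := by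
    have h0K : ({0, i, K} : Finset ℕ).card = 3 := by
      rw [Finset.card_eq_three]; exact ⟨0, i, K, hi0.symm, hK.ne, hiK, rfl⟩
    have hs : ({0, i, K} : Finset ℕ) ⊆ π.toFinset := by
      intro x hx
      simp only [Finset.mem_insert, Finset.mem_singleton] at hx
      rcases hx with rfl | rfl | rfl <;> simp [h.zero_mem, h.last_mem, hi]
    have := (Finset.card_le_card hs).trans (List.toFinset_card_le π)
    omega
  have hlen₁ : e₁.att.length = π.length := by rw [← hψπ, List.length_map]
  refine ⟨hlen, h3, ?_, fun hm A hA hA' => ?_⟩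
  · have h4 : d.V.card ≤ π.length := by
      rw [← hlen₁]
      exact (Finset.card_le_card fun v hv => List.mem_toFinset.2 (hsub v hv)).trans
        (List.toFinset_card_le _)
    have h5 := hd.size_le
    have h6 := edgeSize_le π.length
    have h7 : edgeSize e₂.rank = 1 := by simp [Edge.rank, hu, edgeSize]
    rw [h7, Edge.rank, hlen₁] at h5
    omega
  -- With `m` occurrences every spine edge is used exactly once, so the replacement acts uniformly
  -- along the spine.
  have hTeq : T = Multiset.range m :=
    Multiset.eq_of_le_of_card_le hTm (by rw [hTcard, Multiset.card_range]; exact hm)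
  have hocc := ((spineGraph_isThin h).isOccurrence_iff hd.isHypergraph hd.edges hd.cover).1
    (hL.1 φ₀ hφ₀)
  have hψinj : Set.InjOn ψ d.V := fun x hx y hy hxy =>
    hocc.1 hx hy (by rw [hτ φ₀ hφ₀ x hx, hτ φ₀ hφ₀ y hy, hxy])
  -- The leaf node is the only internal node; the new pattern is therefore `π` without `i`, possibly
  -- permuted.
  have hext : ∀ v ∈ d.V, v ∈ d.ext ↔ v ≠ w := fun v hv => by
    rw [hocc.2.2 v hv, hu, List.mem_singleton]
    simp [hsub v hv]
  have hextV := hd.isHypergraph.ext_subset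
  have hπ' : ∀ j, j ∈ d.ext.map ψ ↔ j ∈ π ∧ j ≠ i := by
    intro j
    constructor
    · intro hj
      obtain ⟨v, hv, rfl⟩ := List.mem_map.1 hj
      refine ⟨?_, fun hc => ?_⟩
      · rw [← hψπ]; exact List.mem_map_of_mem (hsub v (hextV v hv))
      · exact (hext v (hextV v hv)).1 hv (hψinj (hextV v hv) hud (hc.trans hψu.symm))
    · rintro ⟨hj, hji⟩
      rw [← hψπ] at hj
      obtain ⟨v, hv, rfl⟩ := List.mem_map.1 hj
      refine List.mem_map_of_mem ((hext v (hd.left_subset v hv)).2 ?_)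
      rintro rfl
      exact hji hψu
  have hnodup : (d.ext.map ψ).Nodup := hd.isHypergraph.ext_nodup.map_on fun x hx y hy hxy =>
    hψinj (hextV x hx) (hextV y hy) hxy
  have hpat : IsSpinePattern K A (d.ext.map ψ) := by
    refine ⟨hK, hnodup, (hπ' 0).2 ⟨h.zero_mem, hi0.symm⟩, (hπ' K).2 ⟨h.last_mem, hiK.symm⟩,
      fun j hj => h.le_last j ((hπ' j).1 hj).1, ?_, hA'⟩
    rw [hA, HGraph.rank, List.length_map]
  refine ⟨d.ext.map ψ, hpat, ?_, HGraph.eq_of_components ?_ ?_ rfl⟩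
  · have hperm : (d.ext.map ψ).Perm (π.erase i) := by
      rw [List.perm_ext_iff_of_nodup hnodup (h.nodup.erase i)]
      intro j
      rw [hπ', h.nodup.mem_erase_iff, and_comm]
    rw [hperm.length_eq, List.length_erase_of_mem hi]
    omega
  · ext v
    rw [mem_replaceOccs_V, mem_spineGraph_V, mem_spineGraph_V]
    constructor
    · rintro ⟨⟨t, ht, j, hj, rfl⟩, hno⟩
      refine ⟨t, ht, j, (hπ' j).2 ⟨hj, ?_⟩, rfl⟩
      rintro rfl
      have ht' : t ∈ T := by rw [hTeq]; exact Multiset.mem_range.2 ht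
      obtain ⟨φ, hφ, rfl⟩ := Multiset.mem_map.1 ht'
      exact hno ⟨φ, hφ, w, hud, fun hc => (hext w hud).1 hc rfl, by rw [hτ φ hφ w hud, hψu]⟩
    · rintro ⟨t, ht, j, hj, rfl⟩
      refine ⟨⟨t, ht, j, ((hπ' j).1 hj).1, rfl⟩, ?_⟩
      rintro ⟨φ, hφ, v, hv, hve, hφv⟩
      obtain rfl : v = w := by
        by_contra hc
        exact hve ((hext v hv).2 hc)
      rw [hτ φ hφ v hv, hψu] at hφv
      have := mul_add_eq_mul_add hK (h.le_last i hi) (hpat.le_last j hj) hφv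
      have := ((hπ' j).1 hj).2
      omega
  · have hnew : ((L.map fun φ => (⟨A, d.ext.map φ⟩ : Edge) : List Edge) : Multiset Edge) =
        T.map (spineEdge K A (d.ext.map ψ)) := by
      rw [hT, Multiset.map_map, hM, Multiset.map_coe]
      refine congrArg _ (List.map_congr_left fun φ hφ => ?_)
      simp only [spineEdge, Function.comp_def, List.map_map, Edge.mk.injEq, true_and]
      exact List.map_congr_left fun v hv => hτ φ hφ v (hextV v hv)
    have hE : (spineGraph m K Z π).E = (L.map (occEdges d)).sum +
        (leafNodes m K (d.ext.map ψ)).val.map leafEdge := by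
      rw [hsum, hTeq, spineGraph, leafNodes_erase hK h.le_last hi hi0 hiK hπ', Multiset.map_add,
        Multiset.map_map, add_assoc]
      rfl
    simp only [replaceOccs]
    rw [hnew, hTeq, hE, add_tsub_cancel_left, add_comm]
    rfl

/-- A path on `2 * s` vertices has a unique perfect matching: `0` can only be paired with `1`, then
`2` with `3`, and so on. -/
lemma add_map_succ_eq_range {s : ℕ} {T : Multiset ℕ}
    (hT : T + T.map (· + 1) = Multiset.range (2 * s)) :
    T = (Multiset.range s).map (2 * ·) := by
  have hcount : ∀ x, T.count x + (T.map (· + 1)).count x = if x < 2 * s then 1 else 0 := by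
    intro x
    rw [← Multiset.count_add, hT, Multiset.count_eq_of_nodup (Multiset.nodup_range _)]
    simp
  have hsucc : ∀ x, (T.map (· + 1)).count (x + 1) = T.count x := fun x =>
    Multiset.count_map_eq_count' (· + 1) T (fun a b hab => by simpa using hab) x
  have hzero : (T.map (· + 1)).count 0 = 0 := by
    rw [Multiset.count_eq_zero]; simp
  have key : ∀ y, T.count (2 * y) = (if y < s then 1 else 0) ∧ T.count (2 * y + 1) = 0 := by
    intro y
    induction y with
    | zero =>
      have h0 := hcount 0
      have h1 := hcount 1
      rw [hzero] at h0
      rw [hsucc 0] at h1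
      constructor <;> simp only [Nat.mul_zero, Nat.zero_add] at * <;> split_ifs at * <;> omega
    | succ y ih =>
      have h0 := hcount (2 * y + 1 + 1)
      have h1 := hcount (2 * y + 2 + 1)
      rw [hsucc] at h0 h1
      rw [show 2 * y + 1 + 1 = 2 * y + 2 from rfl] at h0
      rw [Nat.mul_succ]
      constructor <;> split_ifs at * <;> omega
  have hinj : Function.Injective fun t : ℕ => 2 * t := fun a b hab => by simpa using hab
  ext x
  rw [Multiset.count_eq_of_nodup ((Multiset.nodup_range s).map hinj)]
  simp only [Multiset.mem_map, Multiset.mem_range]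
  rcases Nat.even_or_odd' x with ⟨y, rfl | rfl⟩
  · rw [(key y).1]
    exact if_congr ⟨fun h => ⟨y, h, rfl⟩, fun ⟨a, h, h'⟩ => by omega⟩ rfl rfl
  · rw [(key y).2, if_neg]
    rintro ⟨a, h, h'⟩
    omega

/-- Without interior offsets only the leaf at the lower end of the spine is left. -/
lemma leafNodes_of_pair (hK : 0 < K) (hm : 0 < m) (hπ : ∀ i, i ∈ π ↔ i = 0 ∨ i = K) :
    leafNodes m K π = {m * K} := by
  ext v
  rw [mem_leafNodes, Finset.mem_singleton]
  constructor
  · rintro ⟨t, ht, i, hi, hi0, hiK, rfl⟩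
    obtain rfl := ((hπ i).1 hi).resolve_left hi0
    rw [← hiK rfl]; ring
  · rintro rfl
    obtain ⟨t, rfl⟩ := Nat.exists_eq_add_of_lt hm
    exact ⟨t, by omega, K, (hπ K).2 (.inr rfl), hK.ne', fun _ => by omega, by ring⟩

lemma mem_spineGraph_V_of_pair (hm : 0 < m) (hπ : ∀ i, i ∈ π ↔ i = 0 ∨ i = K) {v : ℕ} :
    v ∈ (spineGraph m K Z π).V ↔ ∃ x ≤ m, v = x * K := by
  rw [mem_spineGraph_V]
  constructor
  · rintro ⟨t, ht, i, hi, rfl⟩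
    rcases (hπ i).1 hi with rfl | rfl
    · exact ⟨t, ht.le, rfl⟩
    · exact ⟨t + 1, ht, by ring⟩
  · rintro ⟨x, hx, rfl⟩
    rcases hx.lt_or_eq with hx | rfl
    · exact ⟨x, hx, 0, (hπ 0).2 (.inl rfl), rfl⟩
    · obtain ⟨t, rfl⟩ := Nat.exists_eq_add_of_lt hm
      exact ⟨t, by omega, K, (hπ K).2 (.inr rfl), by ring⟩

/-- Replacement of a digram which consists of two spine edges. -/
lemma replace_spine_digram (h : IsSpinePattern K Z π) (hd : d.IsDigramWith e₁ e₂)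
    (hl₁ : e₁.lab = Z) (hl₂ : e₂.lab = Z) {L : List (ℕ → ℕ)}
    (hL : IsNonOverlapping (spineGraph m K Z π) d L) (h2 : 2 ≤ L.length) :
    2 * L.length ≤ m ∧
      (m = 2 * L.length → π.length = 2 → d.size ≤ 10 ∧
        ∀ A : Symb, A.rank = d.rank → A ≠ .term 0 1 →
          ∃ π', IsSpinePattern (2 * K) A π' ∧ π'.length = 2 ∧
            replaceOccs (spineGraph m K Z π) d A L = spineGraph L.length (2 * K) A π') := by
  obtain ⟨φ₀, hφ₀⟩ := List.exists_mem_of_length_pos (show 0 < L.length by omega)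
  obtain ⟨e₁, e₂, ψ, hd, hψ₁, hψ₂, htr⟩ := exists_spine_translation h hd (hL.1 φ₀ hφ₀) hl₁ hl₂
  have htr' : ∀ φ ∈ L, ∃ t, t + 1 < m ∧ ∀ v ∈ d.V, φ v = t * K + ψ v :=
    fun φ hφ => htr φ (hL.1 φ hφ)
  choose! τ hτm hτ using htr'
  have hψπ₁ : e₁.att.map ψ = π := congrArg Edge.att hψ₁
  have hψπ₂ : e₂.att.map ψ = π.map fun i => K + i := congrArg Edge.att hψ₂
  have hl₂ : e₂.lab = Z := congrArg Edge.lab hψ₂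
  set M : Multiset (ℕ → ℕ) := (L : Multiset (ℕ → ℕ)) with hM
  set T : Multiset ℕ := M.map τ with hT
  have hM₁ : M.map (fun φ => e₁.rename φ) = T.map (spineEdge K Z π) := by
    rw [hT, Multiset.map_map]
    refine Multiset.map_congr rfl fun φ hφ => ?_
    exact (rename_eq_spineEdge_iff hψ₁).2 fun v hv => hτ φ hφ v (hd.left_subset v hv)
  have hM₂ : M.map (fun φ => e₂.rename φ) = (T.map (· + 1)).map (spineEdge K Z π) := by
    rw [hT, Multiset.map_map, Multiset.map_map]
    refine Multiset.map_congr rfl fun φ hφ => ?_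
    have h3 : e₂.att.map φ = (e₂.att.map ψ).map fun j => τ φ * K + j := by
      rw [List.map_map]
      exact List.map_congr_left fun v hv => hτ φ hφ v (hd.symm.left_subset v hv)
    simp only [Edge.rename, Function.comp_def, spineEdge, hl₂, h3, hψπ₂, List.map_map,
      Edge.mk.injEq, true_and]
    exact List.map_congr_left fun j _ => by ring
  have hsum : (L.map (occEdges d)).sum = (T + T.map (· + 1)).map (spineEdge K Z π) := by
    rw [sum_map_occEdges hd.edges, hM₁, hM₂, Multiset.map_add]
  have hTm : T + T.map (· + 1) ≤ Multiset.range m := by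
    refine h.le_range_of_map_le ?_
    rw [← hsum]; exact hL.2
  have hTcard : T.card = L.length := by simp [hT, hM]
  have hcard : (T + T.map (· + 1)).card = 2 * L.length := by
    rw [Multiset.card_add, Multiset.card_map _ T, hTcard]; ring
  refine ⟨?_, fun hm hπ2 => ⟨?_, fun A hA hA' => ?_⟩⟩
  · rw [← hcard, ← Multiset.card_range m]; exact Multiset.card_le_card hTm
  · have hlen₁ : e₁.att.length = 2 := by rw [← hπ2, ← hψπ₁, List.length_map]
    have hlen₂ : e₂.att.length = 2 := by
      rw [← List.length_map (f := ψ), hψπ₂, List.length_map, hπ2]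
    have h4 : d.V.card ≤ 4 := by
      have hs : d.V ⊆ e₁.att.toFinset ∪ e₂.att.toFinset := fun v hv => by
        simpa using hd.cover v hv
      have := (Finset.card_le_card hs).trans (Finset.card_union_le _ _)
      have := List.toFinset_card_le e₁.att
      have := List.toFinset_card_le e₂.att
      omega
    have h5 := hd.size_le
    have h6 := edgeSize_le 2
    rw [Edge.rank, Edge.rank, hlen₁, hlen₂] at h5
    omega
  set s := L.length with hs
  -- Equality of the numbers of edges makes the occurrences a perfect matching of consecutive spine
  -- edges, so they start exactly at the even indices.
  have hTeq' : T + T.map (· + 1) = Multiset.range (2 * s) := by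
    rw [← hm]
    exact Multiset.eq_of_le_of_card_le hTm (by rw [hcard, Multiset.card_range, hm])
  have hTeq := add_map_succ_eq_range hTeq'
  have hπ := h.mem_iff_of_length_eq_two hπ2
  have hK := h.pos
  have hocc := ((spineGraph_isThin h).isOccurrence_iff hd.isHypergraph hd.edges hd.cover).1
    (hL.1 φ₀ hφ₀)
  have hψinj : Set.InjOn ψ d.V := fun x hx y hy hxy =>
    hocc.1 hx hy (by rw [hτ φ₀ hφ₀ x hx, hτ φ₀ hφ₀ y hy, hxy])
  have hmem₁ : ∀ v ∈ e₁.att, ψ v = 0 ∨ ψ v = K := fun v hv => by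
    rw [← hπ, ← hψπ₁]; exact List.mem_map_of_mem hv
  have hmem₂ : ∀ v ∈ e₂.att, ψ v = K ∨ ψ v = 2 * K := fun v hv => by
    have : ψ v ∈ π.map fun i => K + i := by rw [← hψπ₂]; exact List.mem_map_of_mem hv
    obtain ⟨i, hi, h⟩ := List.mem_map.1 this
    have := (hπ i).1 hi
    omega
  obtain ⟨w, hwd, hw₁, hw₂⟩ := hd.shared
  have hψw : ψ w = K := by have := hmem₁ w hw₁; have := hmem₂ w hw₂; omega
  have hext : ∀ v ∈ d.V, v ∈ d.ext ↔ ψ v ≠ K := fun v hv => by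
    rw [hocc.2.2 v hv, not_iff_not]
    constructor
    · rintro ⟨h1, h2⟩
      have := hmem₁ v h1; have := hmem₂ v h2; omega
    · intro hc
      obtain rfl : v = w := hψinj hv hwd (hc.trans hψw.symm)
      exact ⟨hw₁, hw₂⟩
  have hextV := hd.isHypergraph.ext_subset
  -- The middle node `K` is internal, and the two ends become the pattern of a spine with period `2
  -- * K`, in either order.
  have hπ' : ∀ j, j ∈ d.ext.map ψ ↔ j = 0 ∨ j = 2 * K := by
    intro j
    constructor
    · intro hj
      obtain ⟨v, hv, rfl⟩ := List.mem_map.1 hj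
      have h3 := (hext v (hextV v hv)).1 hv
      rcases hd.cover v (hextV v hv) with h4 | h4
      · exact .inl ((hmem₁ v h4).resolve_right h3)
      · exact .inr ((hmem₂ v h4).resolve_left h3)
    · rintro (rfl | rfl)
      · have h3 : 0 ∈ e₁.att.map ψ := by rw [hψπ₁]; exact h.zero_mem
        obtain ⟨v, hv, h4⟩ := List.mem_map.1 h3
        exact List.mem_map.2 ⟨v, (hext v (hd.left_subset v hv)).2 (by omega), h4⟩
      · have h3 : 2 * K ∈ e₂.att.map ψ := by
          rw [hψπ₂]; exact List.mem_map.2 ⟨K, h.last_mem, by ring⟩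
        obtain ⟨v, hv, h4⟩ := List.mem_map.1 h3
        exact List.mem_map.2 ⟨v, (hext v (hd.symm.left_subset v hv)).2 (by omega), h4⟩
  have hnodup : (d.ext.map ψ).Nodup := hd.isHypergraph.ext_nodup.map_on fun x hx y hy hxy =>
    hψinj (hextV x hx) (hextV y hy) hxy
  have hpat : IsSpinePattern (2 * K) A (d.ext.map ψ) := by
    refine ⟨by omega, hnodup, (hπ' _).2 (.inl rfl), (hπ' _).2 (.inr rfl), fun j hj => ?_, ?_, hA'⟩
    · have := (hπ' j).1 hj; omega
    · rw [hA, HGraph.rank, List.length_map]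
  refine ⟨d.ext.map ψ, hpat, ?_, HGraph.eq_of_components ?_ ?_ rfl⟩
  · have hperm : (d.ext.map ψ).Perm [0, 2 * K] := by
      rw [List.perm_ext_iff_of_nodup hnodup (by simp; omega)]
      intro j
      rw [hπ']; simp
    rw [hperm.length_eq]; rfl
  · ext v
    rw [mem_replaceOccs_V, mem_spineGraph_V_of_pair (by omega) hπ,
      mem_spineGraph_V_of_pair (by omega) hπ']
    constructor
    · rintro ⟨⟨x, hx, rfl⟩, hno⟩
      rcases Nat.even_or_odd' x with ⟨y, rfl | rfl⟩
      · exact ⟨y, by omega, by ring⟩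
      · have ht' : 2 * y ∈ T := by
          rw [hTeq]; exact Multiset.mem_map_of_mem _ (Multiset.mem_range.2 (by omega))
        obtain ⟨φ, hφ, hφy⟩ := Multiset.mem_map.1 ht'
        refine absurd ⟨φ, hφ, w, hwd, fun hc => (hext w hwd).1 hc hψw, ?_⟩ hno
        rw [hτ φ hφ w hwd, hψw, hφy]; ring
    · rintro ⟨y, hy, rfl⟩
      refine ⟨⟨2 * y, by omega, by ring⟩, ?_⟩
      rintro ⟨φ, hφ, v, hv, hve, hφv⟩
      have hψv : ψ v = K := by
        by_contra hc
        exact hve ((hext v hv).2 hc)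
      have ht' : τ φ ∈ T := Multiset.mem_map_of_mem _ hφ
      rw [hTeq] at ht'
      obtain ⟨x, -, hx⟩ := Multiset.mem_map.1 ht'
      rw [hτ φ hφ v hv, hψv, ← hx] at hφv
      have : 2 * x + 1 = 2 * y := Nat.eq_of_mul_eq_mul_right hK (by
        rw [← mul_assoc, mul_comm y 2] at hφv; linarith)
      omega
  · have hnew : ((L.map fun φ => (⟨A, d.ext.map φ⟩ : Edge) : List Edge) : Multiset Edge) =
        (Multiset.range s).map (spineEdge (2 * K) A (d.ext.map ψ)) := by
      have h3 : (Multiset.range s).map (spineEdge (2 * K) A (d.ext.map ψ)) =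
          T.map (spineEdge K A (d.ext.map ψ)) := by
        rw [hTeq, Multiset.map_map]
        refine Multiset.map_congr rfl fun t _ => ?_
        simp only [spineEdge, Function.comp_def, Edge.mk.injEq, true_and]
        exact List.map_congr_left fun j _ => by ring
      rw [h3, hT, Multiset.map_map, hM, Multiset.map_coe]
      refine congrArg _ (List.map_congr_left fun φ hφ => ?_)
      simp only [spineEdge, Function.comp_def, List.map_map, Edge.mk.injEq, true_and]
      exact List.map_congr_left fun v hv => hτ φ hφ v (hextV v hv)
    -- The end leaf stays where it is, since `s * (2 * K) = m * K`.
    have hleaf : leafNodes s (2 * K) (d.ext.map ψ) = leafNodes m K π := by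
      rw [leafNodes_of_pair (by omega) (by omega) hπ', leafNodes_of_pair hK (by omega) hπ, hm]
      congr 1; ring
    have hE : (spineGraph m K Z π).E = (L.map (occEdges d)).sum +
        (leafNodes m K π).val.map leafEdge := by
      rw [hsum, hTeq', ← hm]; rfl
    simp only [replaceOccs]
    rw [hnew, hE, add_tsub_cancel_left, add_comm]
    simp only [spineGraph, hleaf]

end

/-! ### Active digrams of spine graphs -/

section

variable {m K : ℕ} {Z : Symb} {π : List ℕ}

/-- The pattern edge with a leaf at an interior offset occurs once in every translate. This supplies
the count against which a most frequent digram is measured. -/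
lemma exists_leaf_digram (h : IsSpinePattern K Z π) {i : ℕ} (hi : i ∈ π) (hi0 : i ≠ 0)
    (hiK : i ≠ K) (m : ℕ) : ∃ (d : HGraph) (L : List (ℕ → ℕ)), d.IsDigram ∧
      d.rank + 1 = π.length ∧ IsNonOverlapping (spineGraph m K Z π) d L ∧ L.length = m := by
  have hpos : 0 < π.length := List.length_pos_of_mem hi
  have hK := h.pos
  have hd : HGraph.IsDigramWith ⟨π.toFinset, {⟨Z, π⟩, leafEdge i}, π.erase i⟩ ⟨Z, π⟩
      (leafEdge i) := by
    refine ⟨⟨⟨i, by simpa using hi⟩, ?_, ?_, ?_, ?_, ?_, ?_⟩, rfl, ?_, ?_, ?_⟩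
    · simp only [Multiset.insert_eq_cons, Multiset.mem_cons, Multiset.mem_singleton]
      rintro e (rfl | rfl) v hv
      · simpa using hv
      · simpa [mem_leafEdge.1 hv] using hi
    · simp only [Multiset.insert_eq_cons, Multiset.mem_cons, Multiset.mem_singleton]
      rintro e (rfl | rfl)
      · exact h.nodup
      · simp [leafEdge]
    · simp only [Multiset.insert_eq_cons, Multiset.mem_cons, Multiset.mem_singleton]
      rintro e (rfl | rfl)
      · exact List.ne_nil_of_mem hi
      · simp [leafEdge]
    · simp only [Multiset.insert_eq_cons, Multiset.mem_cons, Multiset.mem_singleton]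
      rintro e (rfl | rfl)
      · exact h.rank_eq.symm
      · rfl
    · intro v hv
      simpa using List.mem_of_mem_erase hv
    · exact h.nodup.erase i
    · intro v hv
      exact .inl (by simpa using hv)
    · exact ⟨i, by simpa using hi, hi, mem_leafEdge.2 rfl⟩
    · exact List.ne_nil_of_mem ((List.mem_erase_of_ne hi0.symm).2 h.zero_mem)
  refine ⟨_, (List.range m).map fun t v => t * K + v, hd.isDigram, ?_, ⟨?_, ?_⟩, by simp⟩
  · simp only [HGraph.rank, List.length_erase_of_mem hi]; omega
  · intro φ hφ
    obtain ⟨t, ht, rfl⟩ := List.mem_map.1 hφ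
    rw [List.mem_range] at ht
    refine ((spineGraph_isThin h).isOccurrence_iff hd.isHypergraph rfl hd.cover).2
      ⟨fun x _ y _ hxy => Nat.add_left_cancel hxy, ⟨fun hc => h.ne_leaf (congrArg Edge.lab hc),
        mem_spineGraph_E.2 (.inl ⟨t, ht, rfl⟩),
        mem_spineGraph_E.2 (.inr ⟨t, ht, i, hi, hi0, fun hc => absurd hc hiK, rfl⟩)⟩, ?_⟩
    intro v hv
    have hv : v ∈ π := by simpa using hv
    simp only [h.nodup.mem_erase_iff, mem_leafEdge]
    tauto
  · rw [sum_map_occEdges rfl, spineGraph]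
    have h1 : (((List.range m).map fun t v => t * K + v : List (ℕ → ℕ)) : Multiset (ℕ → ℕ)) =
        (Multiset.range m).map fun t v => t * K + v := rfl
    rw [h1, Multiset.map_map, Multiset.map_map]
    refine add_le_add le_rfl ?_
    have h2 : ∀ j, j ∈ π.erase i ↔ j ∈ π ∧ j ≠ i := fun j => by
      rw [h.nodup.mem_erase_iff, and_comm]
    rw [leafNodes_erase hK h.le_last hi hi0 hiK h2, Multiset.map_add, Multiset.map_map]
    exact Multiset.le_add_right _ _

/-- The occurrences are the pairs of spine edges `2 * t` and `2 * t + 1`. -/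
lemma exists_spine_digram (h : IsSpinePattern K Z π) (hπ2 : π.length = 2) (s : ℕ) :
    ∃ (d : HGraph) (L : List (ℕ → ℕ)), d.IsDigram ∧ d.rank = 2 ∧
      IsNonOverlapping (spineGraph (2 * s) K Z π) d L ∧ L.length = s := by
  have hK := h.pos
  have hπ := h.mem_iff_of_length_eq_two hπ2
  have hmap : ∀ v, v ∈ (π.map fun i => K + i) ↔ v = K ∨ v = 2 * K := fun v => by
    simp only [List.mem_map, hπ]
    constructor
    · rintro ⟨i, hi, rfl⟩; omega
    · rintro (rfl | rfl)
      · exact ⟨0, .inl rfl, rfl⟩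
      · exact ⟨K, .inr rfl, by ring⟩
  have hd : HGraph.IsDigramWith ⟨{0, K, 2 * K}, {⟨Z, π⟩, ⟨Z, π.map fun i => K + i⟩}, [0, 2 * K]⟩
      ⟨Z, π⟩ ⟨Z, π.map fun i => K + i⟩ := by
    refine ⟨⟨⟨0, by simp⟩, ?_, ?_, ?_, ?_, ?_, ?_⟩, rfl, ?_, ?_, by simp⟩
    · simp only [Multiset.insert_eq_cons, Multiset.mem_cons, Multiset.mem_singleton]
      rintro e (rfl | rfl) v hv
      · have := (hπ v).1 hv
        simp; tauto
      · have := (hmap v).1 hv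
        simp; tauto
    · simp only [Multiset.insert_eq_cons, Multiset.mem_cons, Multiset.mem_singleton]
      rintro e (rfl | rfl)
      · exact h.nodup
      · exact h.nodup.map fun x y hxy => Nat.add_left_cancel hxy
    · simp only [Multiset.insert_eq_cons, Multiset.mem_cons, Multiset.mem_singleton]
      rintro e (rfl | rfl)
      · exact List.ne_nil_of_mem h.zero_mem
      · exact List.ne_nil_of_mem ((hmap K).2 (.inl rfl))
    · simp only [Multiset.insert_eq_cons, Multiset.mem_cons, Multiset.mem_singleton]
      rintro e (rfl | rfl)
      · exact h.rank_eq.symm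
      · simp [Edge.rank, h.rank_eq]
    · intro v hv
      simp only [List.mem_cons, List.not_mem_nil, or_false] at hv
      simp; tauto
    · simp; omega
    · intro v hv
      simp only [Finset.mem_insert, Finset.mem_singleton] at hv
      simp only [hπ, hmap]; tauto
    · exact ⟨K, by simp, h.last_mem, (hmap K).2 (.inl rfl)⟩
  have he : ∀ t, Edge.rename (fun v => 2 * t * K + v) ⟨Z, π.map fun i => K + i⟩ =
      spineEdge K Z π (2 * t + 1) := fun t => by
    simp only [Edge.rename, spineEdge, List.map_map, Edge.mk.injEq, true_and]
    exact List.map_congr_left fun i _ => by simp only [Function.comp_apply]; ring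
  refine ⟨_, (List.range s).map fun t v => 2 * t * K + v, hd.isDigram, rfl, ⟨?_, ?_⟩, by simp⟩
  · intro φ hφ
    obtain ⟨t, ht, rfl⟩ := List.mem_map.1 hφ
    rw [List.mem_range] at ht
    refine ((spineGraph_isThin h).isOccurrence_iff hd.isHypergraph rfl hd.cover).2
      ⟨fun x _ y _ hxy => Nat.add_left_cancel hxy, ⟨fun hc => ?_,
        mem_spineGraph_E.2 (.inl ⟨2 * t, by omega, rfl⟩),
        mem_spineGraph_E.2 (.inl ⟨2 * t + 1, by omega, he t⟩)⟩, ?_⟩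
    · rw [he] at hc
      have := spineEdge_injective h (a₁ := 2 * t) hc
      omega
    · intro v hv
      simp only [Finset.mem_insert, Finset.mem_singleton] at hv
      simp only [hπ, hmap, List.mem_cons, List.not_mem_nil, or_false]
      omega
  · rw [sum_map_occEdges rfl, spineGraph]
    have h1 : (((List.range s).map fun t v => 2 * t * K + v : List (ℕ → ℕ)) : Multiset (ℕ → ℕ)) =
        (Multiset.range s).map fun t v => 2 * t * K + v := rfl
    have h2 : (Multiset.range s).map (fun t => 2 * t) +
        (Multiset.range s).map (fun t => 2 * t + 1) ≤ Multiset.range (2 * s) := by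
      rw [Multiset.le_iff_subset]
      · intro x hx
        simp only [Multiset.mem_add, Multiset.mem_map, Multiset.mem_range] at hx ⊢
        omega
      · refine Multiset.nodup_add.2 ⟨(Multiset.nodup_range s).map fun a b hab => by simpa using hab,
          (Multiset.nodup_range s).map fun a b hab => by simpa using hab, ?_⟩
        rw [Multiset.disjoint_left]
        intro x hx hx'
        simp only [Multiset.mem_map, Multiset.mem_range] at hx hx'
        omega
    have h3 := Multiset.map_le_map (f := spineEdge K Z π) h2
    rw [Multiset.map_add, Multiset.map_map, Multiset.map_map] at h3
    rw [h1, Multiset.map_map, Multiset.map_map]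
    refine le_trans (le_of_eq ?_) (h3.trans (Multiset.le_add_right _ _))
    congr 1
    exact Multiset.map_congr rfl fun t _ => he t

lemma IsSpinePattern.exists_interior (h : IsSpinePattern K Z π) (hπ : 2 < π.length) :
    ∃ i ∈ π, i ≠ 0 ∧ i ≠ K := by
  by_contra hc
  push Not at hc
  have hs : π.toFinset ⊆ {0, K} := fun x hx => by
    have := hc x (List.mem_toFinset.1 hx)
    simp only [Finset.mem_insert, Finset.mem_singleton]
    tauto
  have := Finset.card_le_card hs
  rw [List.toFinset_card_of_nodup h.nodup, Finset.card_pair h.pos.ne] at this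
  omega

/-- The rank of a digram which occurs in a spine graph. -/
lemma length_le_rank_of_isOccurrence (h : IsSpinePattern K Z π) {d : HGraph} (hd : d.IsDigram)
    {φ : ℕ → ℕ} (hφ : IsOccurrence (spineGraph m K Z π) d φ) : π.length ≤ d.rank + 1 := by
  -- Both kinds of digram are reduced to one situation: `e₁` is a spine edge and all nodes shared
  -- with `e₂` have the same offset `c`, so there is only one.
  obtain ⟨e₁, e₂, ψ, c, t, hd, hψ, hc, hτ⟩ : ∃ (e₁ e₂ : Edge) (ψ : ℕ → ℕ) (c t : ℕ),
      d.IsDigramWith e₁ e₂ ∧ e₁.rename ψ = ⟨Z, π⟩ ∧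
      (∀ v, v ∈ e₁.att → v ∈ e₂.att → ψ v = c) ∧ ∀ v ∈ d.V, φ v = t * K + ψ v := by
    have hleaf : ∀ e₁ e₂, d.IsDigramWith e₁ e₂ → e₁.lab = Z → e₂.lab = .term 0 1 →
        ∃ (e₁ e₂ : Edge) (ψ : ℕ → ℕ) (c t : ℕ),
          d.IsDigramWith e₁ e₂ ∧ e₁.rename ψ = ⟨Z, π⟩ ∧
          (∀ v, v ∈ e₁.att → v ∈ e₂.att → ψ v = c) ∧ ∀ v ∈ d.V, φ v = t * K + ψ v := by
      intro e₁ e₂ hd hl₁ hl₂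
      obtain ⟨ψ, i, -, -, hψ₁, hψ₂, htr⟩ := exists_leaf_translation h hd hφ hl₁ hl₂
      obtain ⟨t, -, -, ht⟩ := htr φ hφ
      refine ⟨e₁, e₂, ψ, i, t, hd, hψ₁, fun v _ hv => ?_, ht⟩
      rw [← mem_leafEdge, ← hψ₂]
      exact List.mem_map_of_mem hv
    obtain ⟨e₁, e₂, hd⟩ := hd.exists_with
    rcases leaf_or_spine_of_isOccurrence h hd hφ with ⟨hl₁, hl₂⟩ | ⟨hl₁, hl₂⟩ | ⟨hl₁, hl₂⟩
    · obtain ⟨e₁, e₂, ψ, hd, hψ₁, hψ₂, htr⟩ := exists_spine_translation h hd hφ hl₁ hl₂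
      obtain ⟨t, -, ht⟩ := htr φ hφ
      refine ⟨e₁, e₂, ψ, K, t, hd, hψ₁, fun v hv hv' => ?_, ht⟩
      have h1 : e₁.att.map ψ = π := congrArg Edge.att hψ₁
      have h2 : e₂.att.map ψ = π.map fun i => K + i := congrArg Edge.att hψ₂
      have h3 : ψ v ∈ e₁.att.map ψ := List.mem_map_of_mem hv
      have h4 : ψ v ∈ e₂.att.map ψ := List.mem_map_of_mem hv'
      rw [h1] at h3
      rw [h2] at h4
      obtain ⟨j, -, h4⟩ := List.mem_map.1 h4
      have := h.le_last _ h3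
      omega
    · exact hleaf e₁ e₂ hd hl₁ hl₂
    · exact hleaf e₂ e₁ hd.symm hl₂ hl₁
  have hocc := ((spineGraph_isThin h).isOccurrence_iff hd.isHypergraph hd.edges hd.cover).1 hφ
  obtain ⟨w, hwd, hw₁, hw₂⟩ := hd.shared
  -- Only the shared node of the spine edge is internal; the others contribute to the rank.
  have hs : e₁.att.toFinset ⊆ insert w d.ext.toFinset := by
    intro v hv
    rw [List.mem_toFinset] at hv
    have hvd := hd.left_subset v hv
    rw [Finset.mem_insert, List.mem_toFinset, hocc.2.2 v hvd, or_iff_not_imp_right, not_not]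
    rintro ⟨-, hv₂⟩
    refine hocc.1 hvd hwd ?_
    rw [hτ v hvd, hτ w hwd, hc v hv hv₂, hc w hw₁ hw₂]
  have h1 := (Finset.card_le_card hs).trans (Finset.card_insert_le _ _)
  rw [List.toFinset_card_of_nodup (hd.isHypergraph.att_nodup e₁ (by simp [hd.edges]))] at h1
  have h2 := List.toFinset_card_le d.ext
  have h3 : e₁.att.length = π.length := by
    have h4 : e₁.att.map ψ = π := congrArg Edge.att hψ
    rw [← h4, List.length_map]
  rw [HGraph.rank]
  omega

lemma not_isActive_of_lt {r : ℕ∞} {k : ℕ} (h : IsSpinePattern K Z π) (hk : k + 1 ≤ π.length)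
    (hr : r < k) (d : HGraph) : ¬ IsActive r (spineGraph m K Z π) d := by
  rintro ⟨hd, hdr, L, hL, h2⟩
  obtain ⟨φ, hφ⟩ := List.exists_mem_of_length_pos (show 0 < L.length by omega)
  have h1 := length_le_rank_of_isOccurrence h hd (hL.1 φ hφ)
  have h3 : (k : ℕ∞) ≤ d.rank := Nat.cast_le.2 (by omega)
  exact absurd ((h3.trans hdr).trans_lt hr) (lt_irrefl _)

/-- A replacement loop which has come to an end at a spine graph. -/
lemma le_one_of_not_isActive {r : ℕ∞} {j k : ℕ} (h : IsSpinePattern K Z π)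
    (hk : π.length ≤ k + 1) (hkr : (k : ℕ∞) ≤ r) (h2r : 2 ≤ r)
    (ha : ∀ d, ¬ IsActive r (spineGraph (2 ^ j) K Z π) d) : j ≤ 1 := by
  by_contra hj
  obtain ⟨j, rfl⟩ : ∃ j', j = j' + 2 := ⟨j - 2, by omega⟩
  have hpos : 0 < 2 ^ j := by positivity
  -- At least four spine edges leave an active digram: two disjoint pairs if `π` has length two,
  -- four leaves at an interior offset otherwise.
  rcases h.two_le_length.eq_or_lt with h2 | h2
  · obtain ⟨d, L, hd, hdr, hL, hlen⟩ := exists_spine_digram h h2.symm (2 * 2 ^ j)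
    refine ha d ⟨hd, by rw [hdr]; exact h2r, L, ?_, by omega⟩
    rwa [show 2 ^ (j + 2) = 2 * (2 * 2 ^ j) by ring]
  · obtain ⟨i, hi, hi0, hiK⟩ := h.exists_interior h2
    obtain ⟨d, L, hd, hdr, hL, hlen⟩ := exists_leaf_digram h hi hi0 hiK (2 ^ (j + 2))
    refine ha d ⟨hd, le_trans (Nat.cast_le.2 (by omega)) hkr, L, hL, ?_⟩
    rw [hlen, show 2 ^ (j + 2) = 4 * 2 ^ j by ring]
    omega

/-- A step of the replacement loop turns a spine graph into a spine graph. -/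
lemma LoopStep.exists_spineGraph {r : ℕ∞} {j k : ℕ} {G G' : Grammar} (hs : LoopStep r G G')
    (h : IsSpinePattern K Z π) (hG : G.start = spineGraph (2 ^ j) K Z π)
    (hk : π.length ≤ k + 1) (hkr : (k : ℕ∞) ≤ r) (h2r : 2 ≤ r) :
    ∃ (j' K' : ℕ) (Z' : Symb) (π' : List ℕ) (A : Symb) (d : HGraph), IsSpinePattern K' Z' π' ∧
      G'.start = spineGraph (2 ^ j') K' Z' π' ∧ π'.length ≤ k + 1 ∧
      G'.rules = (A, d) ::ₘ G.rules ∧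
      d.size + (π'.length + 2) ^ 2 + 10 * j' ≤ (π.length + 2) ^ 2 + 10 * j := by
  obtain ⟨d, L, a, ⟨hd, hdr, hL, hmax⟩, h2, -, rfl⟩ := hs
  rw [hG] at hL hmax
  have hπ2 := h.two_le_length
  have hleaf : ∀ e₁ e₂, d.IsDigramWith e₁ e₂ → e₁.lab = Z → e₂.lab = .term 0 1 → _ :=
    fun e₁ e₂ hd hl₁ hl₂ => replace_leaf_digram h hd hl₁ hl₂ hL h2
  have hmax' : 2 < π.length → 2 ^ j ≤ L.length := fun hπ => by
    obtain ⟨i, hi, hi0, hiK⟩ := h.exists_interior hπ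
    obtain ⟨d', L', hd', hdr', hL', hlen⟩ := exists_leaf_digram h hi hi0 hiK (2 ^ j)
    rw [← hlen]
    exact hmax d' L' hd' (le_trans (Nat.cast_le.2 (by omega)) hkr) hL'
  set A := Symb.nonterm a d.rank
  have hA : A.rank = d.rank := rfl
  have hA' : A ≠ .term 0 1 := by simp [A]
  obtain ⟨e₁, e₂, hde⟩ := hd.exists_with
  obtain ⟨φ, hφ⟩ := List.exists_mem_of_length_pos (show 0 < L.length by omega)
  rcases leaf_or_spine_of_isOccurrence h hde (hL.1 φ hφ) with hl | hl
  · obtain ⟨h3, h4⟩ := replace_spine_digram h hde hl.1 hl.2 hL h2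
    -- An interior offset would force `2 ^ j ≤ L.length`, against `2 * L.length ≤ 2 ^ j`: leaf
    -- digrams take precedence over spine digrams.
    have hπ : π.length = 2 := by
      by_contra hc
      have := hmax' (by omega)
      omega
    obtain ⟨i, rfl⟩ : ∃ i, j = i + 1 := by
      cases j with
      | zero => omega
      | succ i => exact ⟨i, rfl⟩
    -- The spine length is a power of two, so a maximum set of pairs covers all of it.
    have hlen : L.length = 2 ^ i := by
      obtain ⟨d', L', hd', hdr', hL', hlen⟩ := exists_spine_digram h hπ (2 ^ i)
      have := hmax d' L' hd' (by rw [hdr']; exact h2r)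
        (by rwa [show 2 ^ (i + 1) = 2 * 2 ^ i by ring])
      rw [pow_succ] at h3
      omega
    obtain ⟨h5, h6⟩ := h4 (by rw [hlen]; ring) hπ
    obtain ⟨π', hπ', hlen', hrep⟩ := h6 A hA hA'
    refine ⟨i, 2 * K, A, π', A, d, hπ', ?_, by omega, rfl, ?_⟩
    · simp only [hG]
      rw [hrep, hlen]
    · rw [hlen', hπ]; omega
  · obtain ⟨h3, h4, h5, h6⟩ : L.length ≤ 2 ^ j ∧ 2 < π.length ∧ d.size ≤ 2 * π.length + 2 ∧
        (2 ^ j ≤ L.length → ∀ A : Symb, A.rank = d.rank → A ≠ .term 0 1 →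
          ∃ π', IsSpinePattern K A π' ∧ π'.length + 1 = π.length ∧
            replaceOccs (spineGraph (2 ^ j) K Z π) d A L =
              spineGraph (2 ^ j) K A π') := by
      rcases hl with hl | hl
      · exact hleaf e₁ e₂ hde hl.1 hl.2
      · exact hleaf e₂ e₁ hde.symm hl.2 hl.1
    obtain ⟨π', hπ', hlen', hrep⟩ := h6 (hmax' h4) A hA hA'
    refine ⟨j, K, A, π', A, d, hπ', ?_, by omega, rfl, ?_⟩
    · simp only [hG]
      rw [hrep]
    -- The potential falls by `(|π| + 2) ^ 2 - (|π| + 1) ^ 2 = 2 * |π| + 3`, which pays for a rule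
    -- of size at most `2 * |π| + 2`.
    · rw [← hlen'] at h5 ⊢
      nlinarith

end

/-! ### The tree-graph of a right comb -/

lemma OrdTree.rootPositions_replicate_append (j : ℕ) (c : OrdTree) (s : ℕ) :
    OrdTree.rootPositions (List.replicate j (.node 0 []) ++ [c]) s =
      (List.range (j + 1)).map (s + ·) := by
  induction j generalizing s with
  | zero => simp [OrdTree.rootPositions]
  | succ j ih =>
    rw [List.range_succ_eq_map, List.replicate_succ, List.cons_append, OrdTree.rootPositions, ih,
      List.map_cons, List.map_map]
    simp only [OrdTree.numNodes, OrdTree.numNodesList, add_zero, List.cons.injEq, true_and]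
    exact List.map_congr_left fun i _ => by simp only [Function.comp_apply]; omega

lemma OrdTree.numNodesList_replicate_append (j : ℕ) (c : OrdTree) :
    OrdTree.numNodesList (List.replicate j (.node 0 []) ++ [c]) = j + c.numNodes := by
  induction j with
  | zero => simp [OrdTree.numNodesList]
  | succ j ih =>
    rw [List.replicate_succ, List.cons_append, OrdTree.numNodesList, ih]
    simp only [OrdTree.numNodes, OrdTree.numNodesList]
    omega

lemma multiset_range_succ' (m : ℕ) :
    Multiset.range (m + 1) = 0 ::ₘ (Multiset.range m).map (· + 1) := by
  rw [← Multiset.coe_range, List.range_succ_eq_map]; rfl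

lemma graphEdges_leaf (s : ℕ) : OrdTree.graphEdges (.node 0 []) s = {leafEdge s} := rfl

lemma OrdTree.graphEdgesList_replicate_append (j : ℕ) (c : OrdTree) (s : ℕ) :
    OrdTree.graphEdgesList (List.replicate j (.node 0 []) ++ [c]) s =
      (Multiset.range j).map (fun i => leafEdge (s + i)) + c.graphEdges (s + j) := by
  induction j generalizing s with
  | zero => simp [OrdTree.graphEdgesList]
  | succ j ih =>
    rw [List.replicate_succ, List.cons_append, OrdTree.graphEdgesList, ih, graphEdges_leaf,
      multiset_range_succ', Multiset.map_cons, Multiset.map_map, Multiset.singleton_add,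
      Multiset.cons_add]
    simp only [OrdTree.numNodes, OrdTree.numNodesList, add_zero, Function.comp_def]
    congr 2
    · exact Multiset.map_congr rfl fun i _ => by congr 1; omega
    · congr 1; omega

lemma comb_numNodes {k : ℕ} (hk : 1 ≤ k) (m : ℕ) : (comb k m).numNodes = m * k + 1 := by
  induction m with
  | zero => simp [comb, OrdTree.numNodes, OrdTree.numNodesList]
  | succ m ih =>
    rw [comb, OrdTree.numNodes, OrdTree.numNodesList_replicate_append, ih, Nat.succ_mul]
    omega

/-- In pre-order each `f`-node is followed by its `k - 1` leaves and then by the next `f`-node, so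
the `t`-th `f`-node has number `s + t * k` and its edge covers `k + 1` consecutive numbers. -/
lemma comb_graphEdges {k : ℕ} (hk : 1 ≤ k) (m s : ℕ) :
    (comb k m).graphEdges s =
      (Multiset.range m).map
        (fun t => ⟨.term 1 (k + 1), (List.range (k + 1)).map fun i => s + t * k + i⟩) +
      ((Multiset.range m).bind fun t =>
        (Multiset.range (k - 1)).map fun i => leafEdge (s + t * k + 1 + i)) +
      {leafEdge (s + m * k)} := by
  induction m generalizing s with
  | zero => simp [comb, graphEdges_leaf]
  | succ m ih =>
    have h1 : (List.replicate (k - 1) (OrdTree.node 0 []) ++ [comb k m]).length = k := by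
      simp; omega
    have h2 : s :: (List.range k).map (s + 1 + ·) =
        (List.range (k + 1)).map fun i => s + 0 * k + i := by
      rw [List.range_succ_eq_map, List.map_cons, List.map_map]
      simp only [Nat.zero_mul, Nat.add_zero, List.cons.injEq, true_and]
      exact List.map_congr_left fun i _ => by simp only [Function.comp_apply]; omega
    rw [comb, OrdTree.graphEdges, OrdTree.graphEdgesList_replicate_append,
      OrdTree.rootPositions_replicate_append, h1, Nat.sub_add_cancel hk, h2, ih,
      multiset_range_succ', Multiset.map_cons, Multiset.cons_bind, Multiset.map_map,
      Multiset.bind_map, show s + 1 + (k - 1) = s + k by omega]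
    have h3 : ∀ t, s + k + t * k = s + (t + 1) * k := fun t => by ring
    simp only [h3, Function.comp_def, Nat.zero_mul, Nat.add_zero, Multiset.cons_add]
    congr 1
    abel

lemma isSpinePattern_range {k : ℕ} (hk : 1 ≤ k) :
    IsSpinePattern k (.term 1 (k + 1)) (List.range (k + 1)) :=
  ⟨hk, List.nodup_range, by simp, by simp, fun i hi => by rw [List.mem_range] at hi; omega,
    by simp [Symb.rank], by simp⟩

lemma tGraph_comb_eq_spineGraph {k m : ℕ} (hk : 1 ≤ k) (hm : 0 < m) :
    (comb k m).tGraph = spineGraph m k (.term 1 (k + 1)) (List.range (k + 1)) := by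
  refine HGraph.eq_of_components ?_ ?_ rfl
  · ext v
    rw [mem_spineGraph_V, OrdTree.tGraph, comb_numNodes hk, Finset.mem_range]
    constructor
    · intro hv
      rcases (Nat.lt_succ_iff.1 hv).lt_or_eq with hv | rfl
      · exact ⟨v / k, (Nat.div_lt_iff_lt_mul hk).2 hv, v % k,
          List.mem_range.2 ((Nat.mod_lt v hk).trans (Nat.lt_succ_self k)),
          (Nat.div_add_mod' v k).symm⟩
      · obtain ⟨t, rfl⟩ := Nat.exists_eq_add_of_lt hm
        exact ⟨t, by omega, k, by simp, by ring⟩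
    · rintro ⟨t, ht, i, hi, rfl⟩
      rw [List.mem_range] at hi
      have := Nat.mul_le_mul_right k ht
      rw [Nat.succ_mul] at this
      omega
  -- The leaves are the `k - 1` interior offsets `1, …, k - 1` of each translate, indexed here from
  -- `0`, together with the last child of the last `f`-node.
  · have hleaf : (leafNodes m k (List.range (k + 1))).val =
        (Multiset.range m ×ˢ Multiset.range (k - 1)).map (fun p => p.1 * k + 1 + p.2) +
          {m * k} := by
      have hinj : ∀ t t' i i', i < k - 1 → i' < k - 1 → t * k + 1 + i = t' * k + 1 + i' →
          t = t' ∧ i = i' := by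
        intro t t' i i' hi hi' htt
        have := mul_add_eq_mul_add (t := t) (t' := t') (i := i) (i' := i') hk (by omega)
          (by omega) (by omega)
        omega
      refine (Multiset.Nodup.ext (leafNodes _ _ _).nodup (Multiset.nodup_add.2
        ⟨Multiset.Nodup.map_on ?_ ((Multiset.nodup_range m).product (Multiset.nodup_range _)),
          Multiset.nodup_singleton _, ?_⟩)).2 fun v => ?_
      · rintro ⟨t, i⟩ hp ⟨t', i'⟩ hp' htt
        rw [Multiset.mem_product, Multiset.mem_range, Multiset.mem_range] at hp hp'
        have := hinj t t' i i' hp.2 hp'.2 htt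
        rw [this.1, this.2]
      · rw [Multiset.disjoint_right]
        intro v hv hv'
        rw [Multiset.mem_singleton] at hv
        subst hv
        obtain ⟨⟨t, i⟩, hp, htt⟩ := Multiset.mem_map.1 hv'
        rw [Multiset.mem_product, Multiset.mem_range, Multiset.mem_range] at hp
        have := Nat.mul_le_mul_right k (show t + 1 ≤ m from hp.1)
        rw [Nat.succ_mul] at this
        have := hp.2
        simp only at *
        omega
      · simp only [Finset.mem_val, mem_leafNodes, Multiset.mem_add, Multiset.mem_map,
          Multiset.mem_product, Multiset.mem_range, Multiset.mem_singleton, Prod.exists,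
          List.mem_range]
        constructor
        · rintro ⟨t, ht, i, hi, hi0, hik, rfl⟩
          by_cases h : i = k
          · subst h
            right
            rw [← hik rfl]; ring
          · exact .inl ⟨t, i - 1, ⟨ht, by omega⟩, by omega⟩
        · rintro (⟨t, i, ⟨ht, hi⟩, rfl⟩ | rfl)
          · exact ⟨t, ht, i + 1, by omega, by omega, by omega, by ring⟩
          · obtain ⟨t, rfl⟩ := Nat.exists_eq_add_of_lt hm
            exact ⟨t, by omega, k, by omega, by omega, fun _ => by omega, by ring⟩
    rw [OrdTree.tGraph, comb_graphEdges hk, spineGraph, hleaf, Multiset.map_add,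
      Multiset.map_map, Multiset.map_singleton]
    simp only [Nat.zero_add, add_assoc]
    congr 2
    rw [show (Multiset.range m ×ˢ Multiset.range (k - 1)) = (Multiset.range m).bind fun t =>
      (Multiset.range (k - 1)).map (Prod.mk t) from rfl, Multiset.map_bind]
    simp only [Multiset.map_map, Function.comp_def]

/-! ### The outputs on right combs -/

section

variable {n k : ℕ} {r : ℕ∞}

lemma combGraph_eq_spineGraph (hk : 1 ≤ k) (n : ℕ) :
    combGraph n k = spineGraph (2 ^ n) k (.term 1 (k + 1)) (List.range (k + 1)) :=
  tGraph_comb_eq_spineGraph hk (by positivity)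

lemma dropVirtual_ofGraph_combGraph (hk : 1 ≤ k) (n : ℕ) :
    (Grammar.ofGraph (combGraph n k)).dropVirtual = Grammar.ofGraph (combGraph n k) := by
  have h : (combGraph n k).dropVirtual = combGraph n k := by
    refine HGraph.eq_of_components rfl (Multiset.filter_eq_self.2 fun e he => ?_) rfl
    rw [combGraph_eq_spineGraph hk] at he
    rcases mem_spineGraph_E.1 he with ⟨t, -, rfl⟩ | ⟨t, -, i, -, -, -, rfl⟩ <;>
      simp [spineEdge, leafEdge]
  simp only [Grammar.dropVirtual, Grammar.ofGraph, h, Multiset.map_zero]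

lemma IsOutput.of_loopResult {g : HGraph} {G : Grammar} (hl : LoopResult r (Grammar.ofGraph g) G)
    (hc : G.start.IsConnected) (hG : G.Sound) : ∃ G', IsOutput r g G' := by
  obtain ⟨G₄, h4⟩ := exists_prune hG
  exact ⟨_, G, G, G, G₄, hl, (connectVirtual_iff hc).2 rfl, loopResult_self hl.2, h4, rfl⟩

/-- When the first run always ends in a connected graph, no virtual edge is added and the second run
starts where nothing is active; only pruning and the final deletion of virtual edges remain. -/
lemma IsOutput.exists_loopResult {g : HGraph} {G : Grammar} (ho : IsOutput r g G)
    (hc : ∀ G, LoopResult r (Grammar.ofGraph g) G → G.start.IsConnected) :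
    ∃ G₁ G₄, LoopResult r (Grammar.ofGraph g) G₁ ∧ Prune G₁ G₄ ∧ G = G₄.dropVirtual := by
  obtain ⟨G₁, G₂, G₃, G₄, h1, h2, h3, h4, rfl⟩ := ho
  obtain rfl := (connectVirtual_iff (hc G₁ h1)).1 h2
  obtain rfl := h3.eq_of_not_isActive h1.2
  exact ⟨_, G₄, h1, h4, rfl⟩

/-- The results of the replacement loop on a right comb. -/
lemma LoopResult.sound_connected_size_le (hk : 1 ≤ k) (hkr : (k : ℕ∞) ≤ r) (h2r : 2 ≤ r)
    {G : Grammar}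
    (hl : LoopResult r (Grammar.ofGraph (combGraph n k)) G) :
    G.Sound ∧ G.start.IsConnected ∧ G.size ≤ 48 * (k ^ 2 + n) := by
  obtain ⟨hl, ha⟩ := hl
  -- Loop invariant: the start graph is a spine graph, and the rules made so far plus the remaining
  -- potential stay within the initial potential `(k + 3) ^ 2 + 10 * n`.
  have key : G.Sound ∧ ∃ (j K : ℕ) (Z : Symb) (π : List ℕ), IsSpinePattern K Z π ∧
      G.start = spineGraph (2 ^ j) K Z π ∧ π.length ≤ k + 1 ∧
      (G.rules.map fun p => p.2.size).sum + (π.length + 2) ^ 2 + 10 * j ≤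
        (k + 3) ^ 2 + 10 * n := by
    clear ha
    induction hl with
    | refl =>
      rw [combGraph_eq_spineGraph hk]
      have hp := isSpinePattern_range hk
      exact ⟨.ofGraph (spineGraph_isHypergraph hp (by positivity)).sound, n, k, _, _, hp, rfl,
        by simp, by simp [Grammar.ofGraph, add_assoc]⟩
    | tail _ hs ih =>
      obtain ⟨hsound, j, K, Z, π, hp, hstart, hlen, hsize⟩ := ih
      obtain ⟨j', K', Z', π', A, d, hp', hstart', hlen', hrules, hsize'⟩ :=
        hs.exists_spineGraph hp hstart hlen hkr h2r
      refine ⟨hs.sound hsound ?_, j', K', Z', π', hp', hstart', hlen', ?_⟩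
      · rw [hstart']
        exact (spineGraph_isHypergraph hp' (by positivity)).sound
      · rw [hrules, Multiset.map_cons, Multiset.sum_cons]
        simp only
        omega
  obtain ⟨hsound, j, K, Z, π, hp, hstart, hlen, hsize⟩ := key
  refine ⟨hsound, hstart ▸ spineGraph_isConnected hp, ?_⟩
  have hj : j ≤ 1 := le_one_of_not_isActive hp hlen hkr h2r (by rwa [hstart] at ha)
  have h2 : 2 ^ j ≤ 2 := by simpa using Nat.pow_le_pow_right (n := 2) (by norm_num) hj
  have h3 : (spineGraph (2 ^ j) K Z π).size ≤ 2 * (3 * π.length + 1) :=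
    spineGraph_size_le.trans (Nat.mul_le_mul_right _ h2)
  have h4 : k * 1 ≤ k * k := Nat.mul_le_mul_left k hk
  rw [Grammar.size, hstart]
  -- The remaining spine of at most two edges has size `O(k)`, and linear and constant terms are
  -- absorbed into `k ^ 2` because `1 ≤ k`; `48` is generous.
  nlinarith

lemma not_isActive_combGraph (hk : 1 ≤ k) (hkr : r < k) (d : HGraph) :
    ¬ IsActive r (combGraph n k) d := by
  rw [combGraph_eq_spineGraph hk]
  exact not_isActive_of_lt (isSpinePattern_range hk) (by simp) hkr d

lemma combGraph_isConnected (hk : 1 ≤ k) (n : ℕ) : (combGraph n k).IsConnected := by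
  rw [combGraph_eq_spineGraph hk]
  exact spineGraph_isConnected (isSpinePattern_range hk)

lemma combGraph_sound (hk : 1 ≤ k) (n : ℕ) : (combGraph n k).Sound := by
  rw [combGraph_eq_spineGraph hk]
  exact (spineGraph_isHypergraph (isSpinePattern_range hk) (by positivity)).sound

end

end GRePair

theorem mainTheorem7 :
    (∃ C : ℕ, ∀ (n k : ℕ) (r : ℕ∞), 1 ≤ k → (k : ℕ∞) ≤ r → 2 ≤ r →
      (∃ G, GRePair.IsOutput r (GRePair.combGraph n k) G) ∧
      ∀ G, GRePair.IsOutput r (GRePair.combGraph n k) G → G.size ≤ C * (k ^ 2 + n)) ∧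
    (∀ (n k : ℕ) (r : ℕ∞), 1 ≤ k → r < (k : ℕ∞) →
      (∃ G, GRePair.IsOutput r (GRePair.combGraph n k) G) ∧
      ∀ G, GRePair.IsOutput r (GRePair.combGraph n k) G →
        G = GRePair.Grammar.ofGraph (GRePair.combGraph n k) ∧
        G.size = (GRePair.combGraph n k).size) := by
  refine ⟨⟨48, fun n k r hk hkr h2r => ⟨?_, fun G hG => ?_⟩⟩,
    fun n k r hk hkr => ⟨?_, fun G hG => ?_⟩⟩
  · obtain ⟨G, hG⟩ := GRePair.exists_loopResult r (.ofGraph (GRePair.combGraph n k))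
    obtain ⟨h1, h2, -⟩ := hG.sound_connected_size_le hk hkr h2r
    exact GRePair.IsOutput.of_loopResult hG h2 h1
  · obtain ⟨G₁, G₄, h1, h2, rfl⟩ :=
      hG.exists_loopResult fun G hG => (hG.sound_connected_size_le hk hkr h2r).2.1
    obtain ⟨h3, -, h4⟩ := h1.sound_connected_size_le hk hkr h2r
    exact (G₄.dropVirtual_size_le.trans (h2.size_le h3)).trans h4
  · exact GRePair.IsOutput.of_loopResult (GRePair.loopResult_self (GRePair.not_isActive_combGraph hk hkr))
      (GRePair.combGraph_isConnected hk n) (.ofGraph (GRePair.combGraph_sound hk n))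
  · have heq : ∀ G, GRePair.LoopResult r (.ofGraph (GRePair.combGraph n k)) G →
        G = .ofGraph (GRePair.combGraph n k) := fun G hG =>
      hG.eq_of_not_isActive (GRePair.not_isActive_combGraph hk hkr)
    obtain ⟨G₁, G₄, h1, h2, rfl⟩ := hG.exists_loopResult fun G hG => by
      rw [heq G hG]; exact GRePair.combGraph_isConnected hk n
    obtain rfl := heq G₁ h1
    rw [h2.eq_of_rules_eq_zero rfl, GRePair.dropVirtual_ofGraph_combGraph hk]
    exact ⟨rfl, by simp [GRePair.Grammar.size, GRePair.Grammar.ofGraph]⟩
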